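/- **Conventions.** Let $M$ be a smooth, Hausdorff, second countable $n$-dimensional manifold without boundary and $N$ a Polish space. A *modulus* is a continuous non-decreasing function $\omega:[0,\infty)\to[0,\infty)$ with $\omega(0)=0$. A function $f:U\to\mathbb R$ on an open set $U\subset\mathbb R^n$ is *$\omega$-semi-concave* if for each $x\in U$ there is a linear form $l_x$ with $$f(y)-f(x)\le l_x(y-x)+\|y-x\|\,\omega(\|y-x\|)\qquad\text{for all }y\in U;$$ it is *locally semi-concave* if every point of $U$ has an open neighbourhood in $U$ on which $f$ is $\omega$-semi-concave for some modulus $\omega$. A function on $M$ is *locally semi-concave* if its expression in every smooth chart is, and *locally semi-convex* if its negative is locally semi-concave. A family $(f_i)_{i\in I}$ of real functions on $M$ is *uniformly locally semi-concave* if $M$ is covered by domains of smooth charts $\theta_j:U_j\to V_j\subset\mathbb R^n$ such that, for each $j$, there is one modulus $\omega_j$ for which all the $f_i\circ\theta_j^{-1}$, $i\in I$, are $\omega_j$-semi-concave on $V_j$. A set $E\subset\mathbb R^n$ is *countably $(n-1)$-Lipschitz* if it is covered by a countable (possibly empty) family of compact sets $K_j$, each contained in the graph of a Lipschitz function $f_j:A_j\to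 H_j^\perp$ on a compact subset $A_j$ of a hyperplane (linear subspace of dimension $n-1$) $H_j$. A set $E\subset M$ is *countably $(n-1)$-Lipschitz* if its image in every smooth chart is. For $c:M\times N\to\mathbb R$, let $\mathcal D$ be the set of $(x,y)$ at which the partial differential $\frac{\partial c}{\partial x}(x,y)\in T^*_xM$ exists, and let $\Lambda:\mathcal D\to T^*M$, $\Lambda(x,y)=(x,\frac{\partial c}{\partial x}(x,y))$. The cost $c$ is *left-twisted* if $\Lambda$ is injective on $\mathcal D$. Given $\bar y\in N$, let $\Lambda^{inv}:T^*M\to M\times N$ be $\Lambda^{-1}$ on $\Lambda(\mathcal D)$ and $\Lambda^{inv}(x,p)=(x,\bar y)$ elsewhere. A pair $\varphi:M\to\mathbb R\cup\{+\infty\}$, $\psi:N\to\mathbb R\cup\{-\infty\}$ is a *$c$-subsolution* if $\psi(y)-\varphi(x)\le c(x,y)$ for all $(x,y)\in M\times N$. **Theorem 3.1.** Let $c:M\times N\to\mathbb R$ be Borel measurable, bounded from below and left-twisted, and suppose that every $y_0\in N$ has a neighbourhood $V_0$ such that the family $(c(\cdot,y))_{y\in V_0}$ is uniformly locally semi-concave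 on $M$. Let $(\varphi,\psi)$ be a $c$-subsolution with $\psi\not\equiv-\infty$, put $$G=\{(x,y)\in M\times N:\psi(y)-\varphi(x)=c(x,y)\},\qquad P=\pi_M(G),$$ where $\pi_M:M\times N\to M$ is the projection, and fix $\bar y\in N$. Then there exist a Borel countably $(n-1)$-Lipschitz set $E\subset M$, a Borel map $T:M\to N$, locally semi-convex functions $\varphi_k:M\to\mathbb R$ and Borel sets $C_k\subset M$ ($k\in\mathbb N$) such that: 1. $G\subset\operatorname{Graph}(T)\cup\pi_M^{-1}(E)$; 2. $\varphi_k\le\varphi_{k+1}\le\varphi$ on $M$ and $C_k\subset C_{k+1}$ for all $k$; 3. for every $k$ and $x\in C_k$, the differentials $d_x\varphi_k$ and $d_x\varphi_{k+1}$ exist and are equal, and $\varphi_{k+1}(x)=\varphi_k(x)$; 4. $P\setminus E\subset\bigcup_k C_k$; 5. for every $k$ and $x\in C_k$, $(x,T(x))=\Lambda^{inv}(x,-d_x\varphi_k)$; 6. for every $k$ and $x\in(P\cap C_k)\setminus E$, we have $(x,T(x))\in\mathcal D$, $\frac{\partial c}{\partial x}(x,T(x))=-d_x\varphi_k$, i.e.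 $\Lambda(x,T(x))=(x,-d_x\varphi_k)$, and $T(x)$ is the only $y\in N$ with $(x,y)\in\mathcal D$ and $\frac{\partial c}{\partial x}(x,y)=-d_x\varphi_k$. -/

import Mathlib

open scoped Manifold ContDiff NNReal Topology

noncomputable section

namespace Transport

/-! ### Semi-concave functions on Euclidean space -/

/-- A modulus (of continuity): a continuous non-decreasing function `[0,∞) → [0,∞)` vanishing
at `0`. -/
structure IsModulus (w : ℝ≥0 → ℝ≥0) : Prop where
  continuous : Continuous w
  monotone : Monotone w
  map_zero : w 0 = 0

/-- `f` is semi-concave with modulus `w` on the (open) set `U`. -/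
def SemiConcaveOnWith {n : ℕ} (w : ℝ≥0 → ℝ≥0) (f : EuclideanSpace ℝ (Fin n) → ℝ)
    (U : Set (EuclideanSpace ℝ (Fin n))) : Prop :=
  ∀ x ∈ U, ∃ l : EuclideanSpace ℝ (Fin n) →L[ℝ] ℝ, ∀ y ∈ U,
    f y - f x ≤ l (y - x) + ‖y - x‖ * (w ‖y - x‖₊ : ℝ)

/-- `f` is locally semi-concave on the (open) set `U`. -/
def LocallySemiConcaveOn {n : ℕ} (f : EuclideanSpace ℝ (Fin n) → ℝ)
    (U : Set (EuclideanSpace ℝ (Fin n))) : Prop :=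
  ∀ x ∈ U, ∃ V : Set (EuclideanSpace ℝ (Fin n)), IsOpen V ∧ x ∈ V ∧ V ⊆ U ∧
    ∃ w : ℝ≥0 → ℝ≥0, IsModulus w ∧ SemiConcaveOnWith w f V

/-- `S ⊆ ℝⁿ` is countably `(n-1)`-Lipschitz: it is covered by a countable (possibly empty) family
of compact sets, each contained in the graph of a Lipschitz function `A → Hᗮ`, where `A` is a
compact subset of a hyperplane `H`. -/
def CountablyLipschitz {n : ℕ} (S : Set (EuclideanSpace ℝ (Fin n))) : Prop :=
  ∃ 𝒦 : Set (Set (EuclideanSpace ℝ (Fin n))), 𝒦.Countable ∧ S ⊆ ⋃₀ 𝒦 ∧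
    ∀ K ∈ 𝒦, IsCompact K ∧
      ∃ H : Submodule ℝ (EuclideanSpace ℝ (Fin n)), Module.finrank ℝ H + 1 = n ∧
        ∃ (A : Set H) (f : H → Hᗮ) (L : ℝ≥0), IsCompact A ∧ LipschitzOnWith L f A ∧
          ∀ z ∈ K, ∃ a ∈ A, z = (a : EuclideanSpace ℝ (Fin n)) + f a

/-! ### The same notions on a smooth manifold, read in its smooth charts -/

section Manifold

variable (n : ℕ) {M : Type*} [TopologicalSpace M] [ChartedSpace (EuclideanSpace ℝ (Fin n)) M]

/-- `f : M → ℝ` is locally semi-concave: so is its expression in every smooth chart. -/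
def IsLocallySemiConcave (f : M → ℝ) : Prop :=
  ∀ e ∈ IsManifold.maximalAtlas (𝓡 n) ∞ M, LocallySemiConcaveOn (f ∘ e.symm) e.target

/-- `f` is locally semi-convex if `-f` is locally semi-concave. -/
def IsLocallySemiConvex (f : M → ℝ) : Prop :=
  IsLocallySemiConcave n (fun x => -f x)

/-- A family of functions on `M` is uniformly locally semi-concave if `M` can be covered by the
domains of smooth charts in each of which the whole family is semi-concave with one modulus. -/
def UniformlyLocallySemiConcave {ι : Type*} (f : ι → M → ℝ) : Prop :=
  ∃ 𝒜 : Set (OpenPartialHomeomorph M (EuclideanSpace ℝ (Fin n))),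
    𝒜 ⊆ IsManifold.maximalAtlas (𝓡 n) ∞ M ∧ (∀ x : M, ∃ e ∈ 𝒜, x ∈ e.source) ∧
      ∀ e ∈ 𝒜, ∃ w : ℝ≥0 → ℝ≥0, IsModulus w ∧
        ∀ i, SemiConcaveOnWith w (f i ∘ e.symm) e.target

/-- `c` is locally semi-concave in its first variable, locally uniformly in the second one. -/
def LocallyUniformlyLocallySemiConcave {N : Type*} [TopologicalSpace N] (c : M × N → ℝ) : Prop :=
  ∀ y₀ : N, ∃ V ∈ 𝓝 y₀, UniformlyLocallySemiConcave n (fun (y : V) (x : M) => c (x, y))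

/-- `S ⊆ M` is countably `(n-1)`-Lipschitz: so is its image in every smooth chart. -/
def IsCountablyLipschitz (S : Set M) : Prop :=
  ∀ e ∈ IsManifold.maximalAtlas (𝓡 n) ∞ M, CountablyLipschitz (e '' (S ∩ e.source))

/-! ### The left Legendre transform of a cost -/

/-- The cotangent space of `M` at `x`. -/
abbrev CotangentSpace (x : M) : Type := TangentSpace (𝓡 n) x →L[ℝ] ℝ

/-- The cotangent bundle of `M` (as a set). -/
abbrev CotangentBundle (M : Type*) [TopologicalSpace M]
    [ChartedSpace (EuclideanSpace ℝ (Fin n)) M] :=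
  Bundle.TotalSpace (EuclideanSpace ℝ (Fin n) →L[ℝ] ℝ) (fun x : M => CotangentSpace n x)

/-- `f` is differentiable at `x`, i.e. `d_x f` exists. -/
def DiffAt (f : M → ℝ) (x : M) : Prop := MDifferentiableAt (𝓡 n) 𝓘(ℝ, ℝ) f x

/-- The differential `d_x f`, meaningful when `f` is differentiable at `x`. -/
def differential (f : M → ℝ) (x : M) : CotangentSpace n x := mvfderiv (𝓡 n) f x

variable {N : Type*}

/-- The partial derivative `∂c/∂x (x, y)`, meaningful on `legendreDomain n c`. -/
def partialDeriv (c : M × N → ℝ) (x : M) (y : N) : CotangentSpace n x :=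
  differential n (fun z => c (z, y)) x

/-- The domain of the skew left Legendre transform: the points where `∂c/∂x` exists. -/
def legendreDomain (c : M × N → ℝ) : Set (M × N) :=
  {p | DiffAt n (fun z => c (z, p.2)) p.1}

/-- The skew left Legendre transform `(x, y) ↦ (x, ∂c/∂x (x, y))`, a partial map with domain
`legendreDomain n c`. -/
def legendre (c : M × N → ℝ) (p : M × N) : CotangentBundle n M :=
  ⟨p.1, partialDeriv n c p.1 p.2⟩

/-- The left twist condition. -/
def LeftTwist (c : M × N → ℝ) : Prop := Set.InjOn (legendre n c) (legendreDomain n c)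

open Classical in
/-- The inverse of the left Legendre transform, extended to the whole cotangent bundle by
`(x, p) ↦ (x, y₀)` outside the image of the transform. -/
def legendreInv (c : M × N → ℝ) (y₀ : N) (ξ : CotangentBundle n M) : M × N :=
  if h : ∃ p ∈ legendreDomain n c, legendre n c p = ξ then h.choose else (ξ.proj, y₀)

end Manifold

/-! ### Subsolutions -/

/-- `(φ, ψ)` is a `c`-subsolution, with `φ` valued in `ℝ ∪ {+∞}` and `ψ` in `ℝ ∪ {-∞}` (so that
the difference `ψ y - φ x` is never of the form `∞ - ∞`). -/
structure IsSubsolution {M N : Type*} (c : M × N → ℝ) (φ : M → EReal) (ψ : N → EReal) : Prop where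
  ne_bot : ∀ x, φ x ≠ ⊥
  ne_top : ∀ y, ψ y ≠ ⊤
  sub_le : ∀ x y, ψ y - φ x ≤ (c (x, y) : EReal)

/-- The contact set `{(x, y) | ψ y - φ x = c (x, y)}`. -/
def contactSet {M N : Type*} (c : M × N → ℝ) (φ : M → EReal) (ψ : N → EReal) : Set (M × N) :=
  {p | ψ p.2 - φ p.1 = (c p : EReal)}

end Transport

end

open scoped Manifold ContDiff NNReal Topology

/-! The potential `φ` has no regularity, so it is replaced from below by the functions `φ_k(x) = sup
(ψ(y) - c(x, y))`, the supremum being over the `y` in a set `W_k`. Here `W_k` consists of the `y`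
with `ψ(y)` finite and at most `k` that lie in one of the first `k + 1` members of a countable cover
of `N` by sets on which `c` is uniformly semi-concave. Then `-φ_k` is a finite minimum of infima of
equi-semi-concave families bounded below, hence locally semi-concave; the subsolution inequality
gives `φ_k ≤ φ`.

If `(x, y)` is a contact point, `y` enters `W_m` for some `m`; from then on `φ_j(x) = φ(x)`, and
`c(·, y) + φ_m` is minimal at `x`. Wherever `φ_m` is differentiable, the semi-concave function `c(·,
y)` is squeezed between two functions differentiable at `x`, so `∂c/∂x(x, y) = -d_x φ_m`
(`differential_eq_neg_of_isLocalMin_add`), and the twist condition recovers `y` from this covector.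
Thus `E` is the union of the sets where some `φ_k` is not differentiable, `C_k` is the set of points
off `E` where the sequence is stationary from `k` on, and `T(x)` is read from `Λ^inv(x, -d_x φ_k)`.

Two facts remain. The set `E` is countably Lipschitz: a semi-concave function has two distinct
supergradients at a point of non-differentiability, and this confines such points to countably many
Lipschitz graphs (`SemiConcaveOnWith.countablyLipschitz`). The map `T` is Borel: the Legendre
transform is an injective Borel map on a Borel domain, so by the Lusin–Souslin theorem it sends
Borel sets to Borel sets (`measurableSet_legendreInv_snd_mem`). -/

namespace Transport
open Set Filter

/-! ### Supergradients, differentiability and the singular set of a semi-concave function on `ℝⁿ`.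
-/

section Euclidean

variable {n : ℕ}

/-- `l` is a supergradient of `f` at `x`, relative to `U` and to the modulus `w`. -/
def IsSuperGradient (w : ℝ≥0 → ℝ≥0) (f : EuclideanSpace ℝ (Fin n) → ℝ)
    (U : Set (EuclideanSpace ℝ (Fin n))) (x : EuclideanSpace ℝ (Fin n))
    (l : EuclideanSpace ℝ (Fin n) →L[ℝ] ℝ) : Prop :=
  ∀ y ∈ U, f y - f x ≤ l (y - x) + ‖y - x‖ * (w ‖y - x‖₊ : ℝ)

variable {w : ℝ≥0 → ℝ≥0} {f : EuclideanSpace ℝ (Fin n) → ℝ}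
  {U : Set (EuclideanSpace ℝ (Fin n))} {x : EuclideanSpace ℝ (Fin n)}

theorem IsModulus.coe_le (hw : IsModulus w) {s t : ℝ≥0} (h : s ≤ t) : (w s : ℝ) ≤ w t :=
  NNReal.coe_le_coe.2 (hw.monotone h)

theorem IsModulus.tendsto_nnnorm_sub (hw : IsModulus w) (x : EuclideanSpace ℝ (Fin n)) :
    Tendsto (fun y => (w ‖y - x‖₊ : ℝ)) (𝓝 x) (𝓝 0) := by
  have : Continuous fun y : EuclideanSpace ℝ (Fin n) => (w ‖y - x‖₊ : ℝ) :=
    NNReal.continuous_coe.comp (hw.continuous.comp (by fun_prop))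
  simpa [hw.map_zero] using this.tendsto x

/-- Test the inequality at the points `x ± r v` with `v` a unit vector: `f` cannot drop by more than
`a - b` there, which bounds `l v` from both sides. -/
theorem IsSuperGradient.norm_le {l : EuclideanSpace ℝ (Fin n) →L[ℝ] ℝ}
    (hl : IsSuperGradient w f U x l) {r : ℝ≥0} (hr : 0 < r) {a b : ℝ}
    (hU : Metric.closedBall x r ⊆ U) (hb : ∀ y ∈ Metric.closedBall x r, b ≤ f y) (ha : f x ≤ a) :
    ‖l‖ ≤ (a - b) / r + w r := by
  have hr' : (0 : ℝ) < r := hr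
  have hba : b ≤ a := (hb x (Metric.mem_closedBall_self hr'.le)).trans ha
  have key : ∀ v : EuclideanSpace ℝ (Fin n), ‖v‖ = 1 → -l v ≤ (a - b) / r + w r := by
    intro v hv
    have hmem : x + (r : ℝ) • v ∈ Metric.closedBall x r := by
      simp [Metric.mem_closedBall, dist_eq_norm, norm_smul, hv]
    have h1 := hl _ (hU hmem)
    have h2 := hb _ hmem
    have h3 : ‖(r : ℝ) • v‖ = r := by simp [norm_smul, hv]
    have h4 : ‖(r : ℝ) • v‖₊ = r := NNReal.eq h3
    rw [add_sub_cancel_left, h3, h4, map_smul, smul_eq_mul] at h1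
    have h5 : (-l v - w r) * r ≤ a - b := by nlinarith
    have := (le_div_iff₀ hr').2 h5
    linarith
  refine ContinuousLinearMap.opNorm_le_of_unit_norm (by positivity) fun v hv => ?_
  rw [Real.norm_eq_abs, abs_le]
  constructor
  · linarith [key v hv]
  · have := key (-v) (by simpa using hv)
    simpa using this

/-- Enclose `x` in a small simplex. For `y` in it, the supergradient inequality at `y` bounds a
linear form from below at the vertices, hence on the whole simplex, and in particular at `y` itself,
where the form cancels. -/
theorem SemiConcaveOnWith.exists_lower_bound (hw : IsModulus w) (hf : SemiConcaveOnWith w f U)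
    (hU : U ∈ 𝓝 x) :
    ∃ r : ℝ≥0, 0 < r ∧ Metric.closedBall x r ⊆ U ∧
      ∃ b : ℝ, ∀ y ∈ Metric.closedBall x r, b ≤ f y := by
  obtain ⟨B, hB, hBU⟩ :=
    exists_mem_interior_convexHull_affineBasis (inter_mem hU (Metric.ball_mem_nhds x one_pos))
  obtain ⟨r, hr, hrB⟩ := Metric.nhds_basis_closedBall.mem_iff.1 (mem_interior_iff_mem_nhds.1 hB)
  obtain ⟨m, hm⟩ := (finite_range fun i => f (B i)).bddBelow
  -- The simplex lies in the unit ball around `x`, so its points are at distance at most `2` from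
  -- the vertices; the error term is then at most `2 * w 2`.
  refine ⟨⟨r, hr.le⟩, hr, hrB.trans (hBU.trans inter_subset_left), m - 2 * w 2, fun y hy => ?_⟩
  have hyH := hrB hy
  obtain ⟨l, hl⟩ := hf y (hBU hyH).1
  have hsub : convexHull ℝ (range B) ⊆ {z | m - f y + l y - 2 * w 2 ≤ l z} := by
    refine convexHull_min ?_ (convex_halfSpace_ge l.toLinearMap.isLinear _)
    rintro _ ⟨i, rfl⟩
    have hi := hBU (subset_convexHull ℝ _ (mem_range_self i))
    have h1 := hl _ hi.1
    have h2 : m ≤ f (B i) := hm (mem_range_self i)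
    have h3 : ‖B i - y‖ ≤ 2 := by
      rw [← dist_eq_norm]
      have h4 := Metric.mem_ball.1 hi.2
      have h5 := Metric.mem_ball.1 (hBU hyH).2
      linarith [dist_triangle_right (B i) y x]
    have h6 : (w ‖B i - y‖₊ : ℝ) ≤ w 2 := hw.coe_le (NNReal.coe_le_coe.1 (by simpa using h3))
    have h7 : ‖B i - y‖ * (w ‖B i - y‖₊ : ℝ) ≤ 2 * w 2 := by gcongr
    rw [map_sub] at h1
    change m - f y + l y - 2 * w 2 ≤ l (B i)
    linarith
  have := hsub hyH
  simp only [mem_ofPred_eq] at this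
  linarith

/-- A supergradient at `x` bounds `f` above near `x`; together with the lower bound,
`IsSuperGradient.norm_le` applies on balls of radius `r / 2` with uniform constants. -/
theorem SemiConcaveOnWith.exists_norm_le (hw : IsModulus w) (hf : SemiConcaveOnWith w f U)
    (hU : U ∈ 𝓝 x) :
    ∃ r : ℝ≥0, 0 < r ∧ Metric.ball x r ⊆ U ∧
      ∃ C : ℝ, ∀ y ∈ Metric.ball x r, ∀ l, IsSuperGradient w f U y l → ‖l‖ ≤ C := by
  obtain ⟨r, hr, hrU, b, hb⟩ := hf.exists_lower_bound hw hU
  obtain ⟨l, hl⟩ := hf x (mem_of_mem_nhds hU)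
  have hr2 : (0 : ℝ) < r / 2 := by positivity
  refine ⟨r / 2, by positivity, fun y hy => hrU ?_,
    (f x + ‖l‖ * r + r * w r - b) / (r / 2 : ℝ≥0) + w (r / 2), fun y hy l' hl' => ?_⟩
  · rw [Metric.mem_ball] at hy
    rw [Metric.mem_closedBall]
    push_cast at hy
    linarith
  · rw [Metric.mem_ball] at hy
    push_cast at hy
    have hsub : Metric.closedBall y (r / 2 : ℝ≥0) ⊆ Metric.closedBall x r := by
      refine Metric.closedBall_subset_closedBall' ?_
      push_cast
      linarith
    have hyx : ‖y - x‖ ≤ r := by rw [← dist_eq_norm]; linarith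
    refine hl'.norm_le (by positivity) (hsub.trans hrU) (fun z hz => hb z (hsub hz)) ?_
    have h1 := hl y (hrU (by rw [Metric.mem_closedBall]; linarith))
    have h2 : l (y - x) ≤ ‖l‖ * r :=
      (le_abs_self _).trans ((l.le_opNorm _).trans (by gcongr))
    have h3 : ‖y - x‖ * (w ‖y - x‖₊ : ℝ) ≤ r * w r := by
      gcongr
      exact hw.coe_le (NNReal.coe_le_coe.1 hyx)
    linarith

theorem SemiConcaveOnWith.continuousAt (hw : IsModulus w) (hf : SemiConcaveOnWith w f U)
    (hU : U ∈ 𝓝 x) : ContinuousAt f x := by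
  obtain ⟨r, hr, hrU, C, hC⟩ := hf.exists_norm_le hw hU
  rw [ContinuousAt, tendsto_iff_dist_tendsto_zero]
  have hlim : Tendsto (fun y => ‖y - x‖ * (C + w ‖y - x‖₊)) (𝓝 x) (𝓝 0) := by
    have h1 : Tendsto (fun y : EuclideanSpace ℝ (Fin n) => ‖y - x‖) (𝓝 x) (𝓝 0) := by
      have : Continuous fun y : EuclideanSpace ℝ (Fin n) => ‖y - x‖ := by fun_prop
      simpa using this.tendsto x
    simpa using h1.mul ((hw.tendsto_nnnorm_sub x).const_add C)
  have hball : Metric.ball x r ∈ 𝓝 x := Metric.ball_mem_nhds x hr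
  refine squeeze_zero' (Eventually.of_forall fun _ => dist_nonneg) ?_ hlim
  filter_upwards [hball] with y hy
  have key : ∀ u ∈ Metric.ball x r, ∀ v ∈ Metric.ball x r,
      f v - f u ≤ ‖v - u‖ * (C + w ‖v - u‖₊) := by
    intro u hu v hv
    obtain ⟨l, hl⟩ := hf u (hrU hu)
    have h1 := hl v (hrU hv)
    have h2 : l (v - u) ≤ C * ‖v - u‖ :=
      (le_abs_self _).trans ((l.le_opNorm _).trans (by gcongr; exact hC u hu l hl))
    linarith
  rw [Real.dist_eq, abs_le]
  have h1 := key x (mem_of_mem_nhds hball) y hy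
  have h2 := key y hy x (mem_of_mem_nhds hball)
  rw [norm_sub_rev, show ‖x - y‖₊ = ‖y - x‖₊ from NNReal.eq (norm_sub_rev x y)] at h2
  constructor <;> linarith

/-- Supergradients near `x` are bounded and their limits are supergradients at `x`, so uniqueness
makes any selection `g` converge to `l`. The inequality at `x` then controls `f y - f x` from above,
and the one at `y` from below. -/
theorem SemiConcaveOnWith.differentiableAt (hw : IsModulus w) (hf : SemiConcaveOnWith w f U)
    (hU : U ∈ 𝓝 x)
    (huniq : ∀ l l', IsSuperGradient w f U x l → IsSuperGradient w f U x l' → l = l') :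
    DifferentiableAt ℝ f x := by
  obtain ⟨r, hr, hrU, C, hC⟩ := hf.exists_norm_le hw hU
  have hball : Metric.ball x r ∈ 𝓝 x := Metric.ball_mem_nhds x hr
  obtain ⟨l, hl⟩ := hf x (mem_of_mem_nhds hU)
  have hf' : ∀ y, ∃ l, y ∈ U → IsSuperGradient w f U y l := by
    intro y
    by_cases hy : y ∈ U
    · obtain ⟨l, hl⟩ := hf y hy
      exact ⟨l, fun _ => hl⟩
    · exact ⟨0, fun h => absurd h hy⟩
  choose g hg using hf'
  have hcont := hf.continuousAt hw hU
  have hlim : Tendsto g (𝓝 x) (𝓝 l) := by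
    refine (isCompact_closedBall (0 : EuclideanSpace ℝ (Fin n) →L[ℝ] ℝ)
      C).tendsto_nhds_of_unique_mapClusterPt ?_ ?_
    · filter_upwards [hball] with y hy
      simpa using hC y hy _ (hg y (hrU hy))
    · intro l' _ hl'
      obtain ⟨u, hux, hul'⟩ := mapClusterPt_iff_ultrafilter.1 hl'
      have hul : Tendsto g u (𝓝 l') := hul'
      refine huniq _ _ (fun z hz => ?_) hl
      have hu : Tendsto (fun y : EuclideanSpace ℝ (Fin n) => y) u (𝓝 x) := hux
      have h1 : Tendsto (fun y => f z - f y) u (𝓝 (f z - f x)) :=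
        (hcont.tendsto.comp hu).const_sub _
      have h2 : Tendsto (fun y => g y (z - y)) u (𝓝 (l' (z - x))) :=
        ((isBoundedBilinearMap_apply (𝕜 := ℝ) (E := EuclideanSpace ℝ (Fin n))
          (F := ℝ)).continuous.tendsto (l', z - x)).comp (hul.prodMk_nhds (hu.const_sub z))
      have h3 : Continuous fun y : EuclideanSpace ℝ (Fin n) =>
          ‖z - y‖ * (w ‖z - y‖₊ : ℝ) :=
        Continuous.mul (by fun_prop)
          (NNReal.continuous_coe.comp (hw.continuous.comp (by fun_prop)))
      refine le_of_tendsto_of_tendsto h1 (h2.add ((h3.tendsto x).comp hu)) ?_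
      filter_upwards [hux hball] with y hy
      exact hg y (hrU hy) z hz
  refine HasFDerivAt.differentiableAt (f' := l) ?_
  rw [hasFDerivAt_iff_isLittleO, Asymptotics.isLittleO_iff]
  intro ε hε
  have hsum : Tendsto (fun y => ‖g y - l‖ + w ‖y - x‖₊) (𝓝 x) (𝓝 0) := by
    simpa using (tendsto_iff_norm_sub_tendsto_zero.1 hlim).add (hw.tendsto_nnnorm_sub x)
  filter_upwards [hball, hsum.eventually_lt_const hε] with y hy hyε
  have h1 := hl y (hrU hy)
  have h2 := hg y (hrU hy) x (mem_of_mem_nhds hU)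
  rw [norm_sub_rev, show ‖x - y‖₊ = ‖y - x‖₊ from NNReal.eq (norm_sub_rev x y),
    ← neg_sub y x, map_neg] at h2
  have h3 := (neg_abs_le ((g y - l) (y - x)))
  have h4 : |(g y - l) (y - x)| ≤ ‖g y - l‖ * ‖y - x‖ := (g y - l).le_opNorm _
  rw [sub_apply] at h3 h4
  have h5 := norm_nonneg (g y - l)
  have h6 : (0 : ℝ) ≤ w ‖y - x‖₊ := NNReal.coe_nonneg _
  have h7 : (‖g y - l‖ + w ‖y - x‖₊) * ‖y - x‖ ≤ ε * ‖y - x‖ := by gcongr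
  have h8 : 0 ≤ ‖g y - l‖ * ‖y - x‖ := by positivity
  rw [Real.norm_eq_abs, abs_le]
  constructor <;> linarith

theorem CountablyLipschitz.mono {S T : Set (EuclideanSpace ℝ (Fin n))} (hT : CountablyLipschitz T)
    (h : S ⊆ T) : CountablyLipschitz S := by
  obtain ⟨𝒦, h𝒦, hcov, hK⟩ := hT
  exact ⟨𝒦, h𝒦, h.trans hcov, hK⟩

theorem CountablyLipschitz.iUnion {ι : Type*} [Countable ι]
    {S : ι → Set (EuclideanSpace ℝ (Fin n))} (hS : ∀ i, CountablyLipschitz (S i)) :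
    CountablyLipschitz (⋃ i, S i) := by
  choose 𝒦 h𝒦 hcov hK using hS
  refine ⟨⋃ i, 𝒦 i, countable_iUnion h𝒦, ?_, ?_⟩
  · rw [sUnion_iUnion]
    exact iUnion_mono hcov
  · intro K hKmem
    obtain ⟨i, hi⟩ := mem_iUnion.1 hKmem
    exact hK i K hi

-- Exchanging `a` and `b` bounds `|⟪v, b - a⟫|`, so differences of points of `S` have a component
-- along `v` no larger than the one orthogonal to `v`. Projection to the hyperplane `vᗮ` is
-- therefore injective, and `S` lies on a `1`-Lipschitz graph. The inequality passes to the closure,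
-- which supplies compactness.
open scoped InnerProductSpace in
theorem countablyLipschitz_of_cone {S : Set (EuclideanSpace ℝ (Fin n))} (hS : Bornology.IsBounded S)
    {v : EuclideanSpace ℝ (Fin n)} (hv : v ≠ 0)
    (hcone : ∀ a ∈ S, ∀ b ∈ S, ⟪v, b - a⟫_ℝ ≤ ‖v‖ / 2 * ‖b - a‖) : CountablyLipschitz S := by
  have hcone' : ∀ a ∈ closure S, ∀ b ∈ closure S, ⟪v, b - a⟫_ℝ ≤ ‖v‖ / 2 * ‖b - a‖ := by
    intro a ha b hb
    have hclosed : IsClosed {p : EuclideanSpace ℝ (Fin n) × EuclideanSpace ℝ (Fin n) |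
        ⟪v, p.2 - p.1⟫_ℝ ≤ ‖v‖ / 2 * ‖p.2 - p.1‖} := isClosed_le (by fun_prop) (by fun_prop)
    have hsub : S ×ˢ S ⊆ {p : EuclideanSpace ℝ (Fin n) × EuclideanSpace ℝ (Fin n) |
        ⟪v, p.2 - p.1⟫_ℝ ≤ ‖v‖ / 2 * ‖p.2 - p.1‖} := fun p hp => hcone _ hp.1 _ hp.2
    have := closure_minimal hsub hclosed
    rw [closure_prod_eq] at this
    exact this (mk_mem_prod ha hb)
  set H : Submodule ℝ (EuclideanSpace ℝ (Fin n)) := (ℝ ∙ v)ᗮ with hH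
  have hcomp : IsCompact (closure S) := hS.isCompact_closure
  have hrank : Module.finrank ℝ H + 1 = n := by
    have h1 := (ℝ ∙ v).finrank_add_finrank_orthogonal
    rw [finrank_span_singleton hv, finrank_euclideanSpace, Fintype.card_fin] at h1
    rw [hH]; omega
  have hdecomp : ∀ d : EuclideanSpace ℝ (Fin n), ‖d‖ ^ 2 =
      ‖H.orthogonalProjectionOnto d‖ ^ 2 + ‖Hᗮ.orthogonalProjectionOnto d‖ ^ 2 :=
    fun d => Submodule.norm_sq_eq_add_norm_sq_projection d H
  have hperp : ∀ d : EuclideanSpace ℝ (Fin n),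
      ‖v‖ * ‖Hᗮ.orthogonalProjectionOnto d‖ = |⟪v, d⟫_ℝ| := by
    intro d
    have h1 : (Hᗮ.orthogonalProjectionOnto d : EuclideanSpace ℝ (Fin n)) =
        (ℝ ∙ v).starProjection d := by
      have : Hᗮ = ℝ ∙ v := by rw [hH, Submodule.orthogonal_orthogonal]
      rw [← Submodule.starProjection_apply]
      congr!
    rw [← Submodule.norm_coe, h1, Submodule.starProjection_singleton, norm_smul, Real.norm_eq_abs,
      abs_div]
    have hv' : ‖v‖ ≠ 0 := norm_ne_zero_iff.2 hv
    simp
    field_simp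
  have hlip : ∀ a ∈ closure S, ∀ b ∈ closure S,
      ‖Hᗮ.orthogonalProjectionOnto (b - a)‖ ≤ ‖H.orthogonalProjectionOnto (b - a)‖ := by
    intro a ha b hb
    have h1 := hcone' a ha b hb
    have h2 := hcone' b hb a ha
    rw [← neg_sub b a, inner_neg_right, norm_neg] at h2
    have h3 : |⟪v, b - a⟫_ℝ| ≤ ‖v‖ / 2 * ‖b - a‖ := abs_le.2 ⟨by linarith, h1⟩
    rw [← hperp] at h3
    have hv' : 0 < ‖v‖ := norm_pos_iff.2 hv
    have h4 : ‖Hᗮ.orthogonalProjectionOnto (b - a)‖ ≤ ‖b - a‖ / 2 := by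
      refine le_of_mul_le_mul_left (h3.trans_eq (by ring)) hv'
    have h5 := hdecomp (b - a)
    have h6 := norm_nonneg (Hᗮ.orthogonalProjectionOnto (b - a))
    refine le_of_sq_le_sq ?_ (norm_nonneg _)
    nlinarith
  have hinj : InjOn (fun z => H.orthogonalProjectionOnto z) (closure S) := by
    intro a ha b hb hab
    have h1 := hlip a ha b hb
    have h2 : H.orthogonalProjectionOnto (b - a) = 0 := by
      rw [map_sub, sub_eq_zero]; exact hab.symm
    have h3 := hdecomp (b - a)
    rw [h2, norm_zero] at h1 h3
    have h4 := le_antisymm h1 (norm_nonneg _)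
    rw [h4] at h3
    have : ‖b - a‖ = 0 := by simpa using h3
    exact (sub_eq_zero.1 (norm_eq_zero.1 this)).symm
  set g := Function.invFunOn (fun z => H.orthogonalProjectionOnto z) (closure S)
  have hgl : ∀ z ∈ closure S, g (H.orthogonalProjectionOnto z) = z := fun z hz =>
    hinj.leftInvOn_invFunOn hz
  refine ⟨{closure S}, countable_singleton _, by simpa using subset_closure, ?_⟩
  rintro K rfl
  refine ⟨hcomp, H, hrank, (fun z => H.orthogonalProjectionOnto z) '' closure S,
    fun h => Hᗮ.orthogonalProjectionOnto (g h), 1,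
    hcomp.image H.orthogonalProjectionOnto.continuous, ?_, ?_⟩
  · refine LipschitzOnWith.of_dist_le_mul ?_
    rintro _ ⟨a, ha, rfl⟩ _ ⟨b, hb, rfl⟩
    dsimp only
    rw [hgl a ha, hgl b hb, dist_eq_norm, dist_eq_norm, ← map_sub, ← map_sub]
    simpa using hlip b hb a ha
  · intro z hz
    refine ⟨_, mem_image_of_mem _ hz, ?_⟩
    dsimp only
    rw [hgl z hz]
    have := H.starProjection_add_starProjection_orthogonal z
    exact this.symm

-- Take supergradients `l ≠ l'` at each singular point and sort the points into countably many
-- pieces, with `l`, `l'` and the point itself near members of a dense sequence. For `a`, `b` in one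
-- piece, adding the inequality for `l` at `a` to that for `l'` at `b` bounds `(l' - l)(b - a)` from
-- above, up to small errors: this is the cone condition with `v = d j - d i`.
open scoped InnerProductSpace in
theorem SemiConcaveOnWith.countablyLipschitz (hw : IsModulus w) (hf : SemiConcaveOnWith w f U)
    (hU : IsOpen U) : CountablyLipschitz {x ∈ U | ¬ DifferentiableAt ℝ f x} := by
  have hrad : ∀ v : EuclideanSpace ℝ (Fin n), ∃ r : ℝ≥0, 0 < r ∧
      (v ≠ 0 → (w (2 * r) : ℝ) ≤ ‖v‖ / 16) := by
    intro v
    by_cases hv : v = 0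
    · exact ⟨1, one_pos, fun h => absurd hv h⟩
    have hv' : 0 < ‖v‖ / 16 := by have := norm_pos_iff.2 hv; positivity
    have hcont : Tendsto (fun s : ℝ≥0 => (w (2 * s) : ℝ)) (𝓝[>] 0) (𝓝 0) := by
      have h1 : Continuous fun s : ℝ≥0 => (w (2 * s) : ℝ) :=
        NNReal.continuous_coe.comp (hw.continuous.comp (by fun_prop))
      have h2 := h1.tendsto 0
      rw [mul_zero, hw.map_zero, NNReal.coe_zero] at h2
      exact h2.mono_left nhdsWithin_le_nhds
    obtain ⟨r, hr, hr0⟩ := ((hcont.eventually_lt_const hv').and self_mem_nhdsWithin).exists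
    exact ⟨r, hr0, fun _ => hr.le⟩
  choose r hr hrw using hrad
  let d := TopologicalSpace.denseSeq (EuclideanSpace ℝ (Fin n))
  let D := InnerProductSpace.toDual ℝ (EuclideanSpace ℝ (Fin n))
  let Z : ℕ × ℕ × ℕ → Set (EuclideanSpace ℝ (Fin n)) := fun i =>
    {x | x ∈ U ∧ x ∈ Metric.ball (d i.2.2) (r (d i.2.1 - d i.1)) ∧ d i.2.1 - d i.1 ≠ 0 ∧
      ∃ l l', IsSuperGradient w f U x l ∧ IsSuperGradient w f U x l' ∧
        ‖l - D (d i.1)‖ ≤ ‖d i.2.1 - d i.1‖ / 16 ∧ ‖l' - D (d i.2.1)‖ ≤ ‖d i.2.1 - d i.1‖ / 16}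
  have hZ : ∀ i, CountablyLipschitz (Z i) := by
    rintro ⟨i, j, k⟩
    by_cases hne : d j - d i = 0
    · refine ⟨∅, countable_empty, ?_, by simp⟩
      rintro x ⟨-, -, h, -⟩
      exact absurd hne h
    refine countablyLipschitz_of_cone (v := d j - d i)
      (Metric.isBounded_ball.subset fun x hx => hx.2.1) hne ?_
    rintro a ⟨haU, hab, -, l, -, hl, -, hlD, -⟩ b ⟨hbU, hbb, -, -, m, -, hm, -, hmD⟩
    dsimp only at hab hbb hlD hmD
    have h1 := hl b hbU
    have h2 := hm a haU
    rw [norm_sub_rev, show ‖a - b‖₊ = ‖b - a‖₊ from NNReal.eq (norm_sub_rev a b),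
      ← neg_sub b a, map_neg] at h2
    -- Both points lie in a ball of radius `r (d j - d i)`, whence the `2 * r` in the choice of `r`.
    -- Two modulus terms and two approximation errors, each at most `‖v‖ / 16 * ‖b - a‖`, add up to
    -- less than the allowed half.
    have hdist : ‖b - a‖₊ ≤ 2 * r (d j - d i) := by
      rw [← NNReal.coe_le_coe, coe_nnnorm, ← dist_eq_norm]
      push_cast
      rw [Metric.mem_ball] at hab hbb
      linarith [dist_triangle_right b a (d k)]
    have hwle := (hw.coe_le hdist).trans (hrw _ hne)
    have h3 : ‖b - a‖ * (w ‖b - a‖₊ : ℝ) ≤ ‖b - a‖ * (‖d j - d i‖ / 16) := by gcongr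
    have h4 : -((m - D (d j)) (b - a)) ≤ ‖d j - d i‖ / 16 * ‖b - a‖ :=
      (neg_le_abs _).trans (((m - D (d j)).le_opNorm _).trans (by gcongr))
    have h5 : (l - D (d i)) (b - a) ≤ ‖d j - d i‖ / 16 * ‖b - a‖ :=
      (le_abs_self _).trans (((l - D (d i)).le_opNorm _).trans (by gcongr))
    rw [sub_apply] at h4 h5
    have h6 : ⟪d j - d i, b - a⟫_ℝ = D (d j) (b - a) - D (d i) (b - a) := by
      rw [inner_sub_left]; rfl
    have h7 : 0 ≤ ‖d j - d i‖ * ‖b - a‖ := by positivity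
    linarith
  refine (CountablyLipschitz.iUnion hZ).mono ?_
  rintro x ⟨hxU, hx⟩
  have hex : ∃ l l', IsSuperGradient w f U x l ∧ IsSuperGradient w f U x l' ∧ l ≠ l' := by
    by_contra! h
    exact hx (hf.differentiableAt hw (hU.mem_nhds hxU) h)
  obtain ⟨l, l', hl, hl', hne⟩ := hex
  have hdense : DenseRange d := TopologicalSpace.denseRange_denseSeq _
  have hpos : 0 < ‖D.symm l' - D.symm l‖ := by
    rw [norm_pos_iff, sub_ne_zero]
    exact fun h => hne (D.symm.injective h).symm
  -- With both errors below `1/32` of the gap, `‖d j - d i‖` exceeds half the gap, so that the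
  -- errors are below `‖d j - d i‖ / 16`.
  obtain ⟨i, hi⟩ := hdense.exists_dist_lt (D.symm l) (show 0 < ‖D.symm l' - D.symm l‖ / 32 by
    positivity)
  obtain ⟨j, hj⟩ := hdense.exists_dist_lt (D.symm l') (show 0 < ‖D.symm l' - D.symm l‖ / 32 by
    positivity)
  obtain ⟨k, hk⟩ := hdense.exists_dist_lt x (hr (d j - d i))
  rw [dist_eq_norm] at hi hj
  have htri : ‖D.symm l' - D.symm l‖ ≤ ‖D.symm l' - d j‖ + ‖d j - d i‖ + ‖D.symm l - d i‖ := by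
    have h1 : D.symm l' - D.symm l = (D.symm l' - d j) + (d j - d i) - (D.symm l - d i) := by abel
    rw [h1]
    exact (norm_sub_le _ _).trans (by gcongr; exact norm_add_le _ _)
  have hD : ∀ (g : EuclideanSpace ℝ (Fin n) →L[ℝ] ℝ) z, ‖g - D z‖ = ‖D.symm g - z‖ := by
    intro g z
    rw [← D.norm_map (D.symm g - z), map_sub, D.apply_symm_apply]
  refine mem_iUnion.2 ⟨(i, j, k), hxU, hk, ?_, l, l', hl, hl', ?_, ?_⟩
  · rw [← norm_pos_iff]
    dsimp only
    linarith
  · rw [hD]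
    dsimp only
    linarith
  · rw [hD]
    dsimp only
    linarith

theorem LocallySemiConcaveOn.countablyLipschitz (hf : LocallySemiConcaveOn f U) :
    CountablyLipschitz {x ∈ U | ¬ DifferentiableAt ℝ f x} := by
  choose V hVo hxV hVU w hw hfV using hf
  obtain ⟨T, hT, hTU⟩ := TopologicalSpace.isOpen_iUnion_countable
    (fun x : U => V x x.2) fun x => hVo x x.2
  have := hT.to_subtype
  refine (CountablyLipschitz.iUnion fun x : T =>
    (hfV x x.1.2).countablyLipschitz (hw x x.1.2) (hVo x x.1.2)).mono ?_
  rintro x ⟨hxU, hx⟩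
  have hmem : x ∈ ⋃ x : U, V x x.2 := mem_iUnion.2 ⟨⟨x, hxU⟩, hxV x hxU⟩
  rw [← hTU] at hmem
  obtain ⟨y, hyT, hy⟩ := mem_iUnion₂.1 hmem
  exact mem_iUnion.2 ⟨⟨y, hyT⟩, hy, hx⟩

theorem LocallySemiConcaveOn.continuousAt (hf : LocallySemiConcaveOn f U) (hx : x ∈ U) :
    ContinuousAt f x := by
  obtain ⟨V, hVo, hxV, -, w, hw, hfV⟩ := hf x hx
  exact hfV.continuousAt hw (hVo.mem_nhds hxV)

end Euclidean

/-! ### Stability of semi-concavity under minima, infima and changes of coordinates. -/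

section Euclidean

variable {n : ℕ} {w w' : ℝ≥0 → ℝ≥0} {f g : EuclideanSpace ℝ (Fin n) → ℝ}
  {U V : Set (EuclideanSpace ℝ (Fin n))} {x : EuclideanSpace ℝ (Fin n)}

theorem SemiConcaveOnWith.mono (hf : SemiConcaveOnWith w f V) (h : U ⊆ V) :
    SemiConcaveOnWith w f U := fun x hx =>
  (hf x (h hx)).imp fun _ hl y hy => hl y (h hy)

theorem SemiConcaveOnWith.congr (hf : SemiConcaveOnWith w f U) (h : EqOn g f U) :
    SemiConcaveOnWith w g U := fun x hx =>
  (hf x hx).imp fun _ hl y hy => by rw [h hx, h hy]; exact hl y hy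

theorem IsModulus.add (hw : IsModulus w) (hw' : IsModulus w') :
    IsModulus (fun s => w s + w' s) where
  continuous := hw.continuous.add hw'.continuous
  monotone := hw.monotone.add hw'.monotone
  map_zero := by simp [hw.map_zero, hw'.map_zero]

theorem SemiConcaveOnWith.min (hf : SemiConcaveOnWith w f U) (hg : SemiConcaveOnWith w' g U) :
    SemiConcaveOnWith (fun s => w s + w' s) (fun x => min (f x) (g x)) U := by
  intro x hx
  have aux : ∀ (s t : ℝ≥0) (d : ℝ), 0 ≤ d →
      d * (s : ℝ) ≤ d * ((s + t : ℝ≥0) : ℝ) ∧ d * (t : ℝ) ≤ d * ((s + t : ℝ≥0) : ℝ) := by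
    intro s t d hd
    constructor <;> gcongr <;> simp
  rcases le_total (f x) (g x) with h | h
  · obtain ⟨l, hl⟩ := hf x hx
    refine ⟨l, fun y hy => ?_⟩
    simp only [min_eq_left h]
    have h1 := hl y hy
    have h2 := min_le_left (f y) (g y)
    have h3 := (aux (w ‖y - x‖₊) (w' ‖y - x‖₊) _ (norm_nonneg (y - x))).1
    linarith
  · obtain ⟨l, hl⟩ := hg x hx
    refine ⟨l, fun y hy => ?_⟩
    simp only [min_eq_right h]
    have h1 := hl y hy
    have h2 := min_le_right (f y) (g y)
    have h3 := (aux (w ‖y - x‖₊) (w' ‖y - x‖₊) _ (norm_nonneg (y - x))).2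
    linarith

theorem LocallySemiConcaveOn.min (hf : LocallySemiConcaveOn f U) (hg : LocallySemiConcaveOn g U) :
    LocallySemiConcaveOn (fun x => min (f x) (g x)) U := by
  intro x hx
  obtain ⟨V, hV, hxV, hVU, w, hw, hfV⟩ := hf x hx
  obtain ⟨V', hV', hxV', -, w', hw', hgV'⟩ := hg x hx
  exact ⟨V ∩ V', hV.inter hV', ⟨hxV, hxV'⟩, inter_subset_left.trans hVU, _, hw.add hw',
    (hfV.mono inter_subset_left).min (hgV'.mono inter_subset_right)⟩

/-- The infimum need not be attained: take supergradients at `x` of members that are nearly minimal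
there. The common lower bound `b` keeps them bounded, and the limit of a subsequence is a
supergradient of the infimum. -/
theorem SemiConcaveOnWith.iInf {ι : Type*} [Nonempty ι] {F : ι → EuclideanSpace ℝ (Fin n) → ℝ}
    (hU : IsOpen U) (hF : ∀ i, SemiConcaveOnWith w (F i) U) {b : ℝ}
    (hb : ∀ i, ∀ x ∈ U, b ≤ F i x) : SemiConcaveOnWith w (fun x => ⨅ i, F i x) U := by
  intro x hx
  obtain ⟨r, hr, hrU⟩ := Metric.nhds_basis_closedBall.mem_iff.1 (hU.mem_nhds hx)
  have hex : ∀ m : ℕ, ∃ i, F i x < (⨅ i, F i x) + 1 / ((m : ℝ) + 1) := fun m =>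
    exists_lt_of_ciInf_lt (lt_add_of_pos_right _ Nat.one_div_pos_of_nat)
  choose i hi using hex
  choose l hl using fun m => hF (i m) x hx
  have hbound : ∀ m, l m ∈ Metric.closedBall (0 : EuclideanSpace ℝ (Fin n) →L[ℝ] ℝ)
      (((⨅ i, F i x) + 1 - b) / r + w ⟨r, hr.le⟩) := by
    intro m
    rw [mem_closedBall_zero_iff]
    refine IsSuperGradient.norm_le (f := F (i m)) (hl m) (r := ⟨r, hr.le⟩) hr hrU
      (fun y hy => hb _ y (hrU hy)) ?_
    have h1 : 1 / ((m : ℝ) + 1) ≤ 1 := by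
      rw [div_le_one (by positivity)]
      linarith [Nat.cast_nonneg (α := ℝ) m]
    linarith [hi m]
  obtain ⟨l', -, s, hs, hlim⟩ := tendsto_subseq_of_bounded Metric.isBounded_closedBall hbound
  refine ⟨l', fun z hz => ?_⟩
  have h1 : Tendsto (fun m => l (s m) (z - x)) atTop (𝓝 (l' (z - x))) :=
    ((isBoundedBilinearMap_apply (𝕜 := ℝ) (E := EuclideanSpace ℝ (Fin n))
      (F := ℝ)).continuous.tendsto (l', z - x)).comp (hlim.prodMk_nhds tendsto_const_nhds)
  have h2 : Tendsto (fun m => 1 / ((s m : ℝ) + 1)) atTop (𝓝 0) :=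
    tendsto_one_div_add_atTop_nhds_zero_nat.comp hs.tendsto_atTop
  have h3 := (h1.add_const (‖z - x‖ * (w ‖z - x‖₊ : ℝ))).add h2
  rw [add_zero] at h3
  refine ge_of_tendsto' h3 fun m => ?_
  have h4 := hl (s m) z hz
  have h5 := hi (s m)
  have h6 : ⨅ i, F i z ≤ F (i (s m)) z :=
    ciInf_le ⟨b, by rintro _ ⟨j, rfl⟩; exact hb j z hz⟩ _
  linarith

/-- Pull supergradients back by the derivative of `τ`. With `L` bounding the supergradients, `C` a
Lipschitz constant of the derivative and `K` one of `τ`, the first-order Taylor error costs `L * C *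
s` and the old modulus becomes `K * w (K * s)`. -/
theorem SemiConcaveOnWith.comp_contDiffAt (hw : IsModulus w) (hf : SemiConcaveOnWith w f V)
    (hV : IsOpen V) {τ : EuclideanSpace ℝ (Fin n) → EuclideanSpace ℝ (Fin n)}
    (hτ : ContDiffAt ℝ 2 τ x) (hx : τ x ∈ V) :
    ∃ r : ℝ, 0 < r ∧ ∃ w' : ℝ≥0 → ℝ≥0, IsModulus w' ∧
      SemiConcaveOnWith w' (f ∘ τ) (Metric.ball x r) := by
  obtain ⟨ρ, hρ, hρV, L, hL⟩ := hf.exists_norm_le hw (hV.mem_nhds hx)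
  obtain ⟨C, t, ht, hC⟩ := (hτ.fderiv_right (m := 1) (by norm_num)).exists_lipschitzOnWith
  obtain ⟨K, t', ht', hK⟩ := (hτ.of_le (by norm_num : (1 : ℕ∞ω) ≤ 2)).exists_lipschitzOnWith
  have hdiff : ∀ᶠ y in 𝓝 x, DifferentiableAt ℝ τ y :=
    (hτ.eventually (by simp)).mono fun y hy => hy.differentiableAt (by simp)
  have hball : ∀ᶠ y in 𝓝 x, τ y ∈ Metric.ball (τ x) ρ :=
    hτ.continuousAt (Metric.ball_mem_nhds _ hρ)
  obtain ⟨r, hr, hrsub⟩ := Metric.mem_nhds_iff.1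
    (inter_mem (inter_mem ht ht') (inter_mem hdiff hball))
  refine ⟨r, hr, fun s => L.toNNReal * C * s + K * w (K * s), ⟨?_, ?_, ?_⟩, ?_⟩
  · exact (by fun_prop : Continuous fun s : ℝ≥0 => L.toNNReal * C * s).add
      (continuous_const.mul (hw.continuous.comp (by fun_prop)))
  · intro s s' h
    have := hw.monotone (show K * s ≤ K * s' by gcongr)
    dsimp only
    gcongr
  · simp [hw.map_zero]
  intro y hy
  obtain ⟨l, hl⟩ := hf (τ y) (hρV (hrsub hy).2.2)
  refine ⟨l.comp (fderiv ℝ τ y), fun z hz => ?_⟩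
  have hseg : segment ℝ y z ⊆ Metric.ball x r := (convex_ball x r).segment_subset hy hz
  have h1 : ‖τ z - τ y - fderiv ℝ τ y (z - y)‖ ≤ (C * ‖z - y‖) * ‖z - y‖ := by
    refine Convex.norm_image_sub_le_of_norm_hasFDerivWithin_le' (s := segment ℝ y z)
      (f' := fderiv ℝ τ) (fun v hv => ?_) (fun v hv => ?_) (convex_segment y z)
      (left_mem_segment ℝ y z) (right_mem_segment ℝ y z)
    · exact (hrsub (hseg hv)).2.1.hasFDerivAt.hasFDerivWithinAt
    · refine (hC.norm_sub_le (hrsub (hseg hv)).1.1 (hrsub hy).1.1).trans ?_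
      gcongr
      obtain ⟨θ, hθ, rfl⟩ := (segment_eq_image' ℝ y z ▸ hv : v ∈ _ '' _)
      rw [add_sub_cancel_left, norm_smul, Real.norm_eq_abs, abs_of_nonneg hθ.1]
      exact mul_le_of_le_one_left (norm_nonneg _) hθ.2
  have h2 : ‖τ z - τ y‖ ≤ K * ‖z - y‖ := hK.norm_sub_le (hrsub hz).1.2 (hrsub hy).1.2
  have h3 := hl (τ z) (hρV (hrsub hz).2.2)
  have h4 : (w ‖τ z - τ y‖₊ : ℝ) ≤ w (K * ‖z - y‖₊) :=
    hw.coe_le (NNReal.coe_le_coe.1 (by simpa using h2))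
  have h5 : ‖l‖ ≤ L.toNNReal :=
    (hL _ (hrsub hy).2.2 l hl).trans (Real.le_coe_toNNReal L)
  have h6 : l (τ z - τ y - fderiv ℝ τ y (z - y)) ≤ L.toNNReal * ((C * ‖z - y‖) * ‖z - y‖) :=
    (le_abs_self _).trans ((l.le_opNorm _).trans (by gcongr))
  rw [map_sub l (τ z - τ y)] at h6
  have h7 : ‖τ z - τ y‖ * (w ‖τ z - τ y‖₊ : ℝ) ≤ K * ‖z - y‖ * w (K * ‖z - y‖₊) := by gcongr
  push_cast
  simp only [Function.comp_apply]
  change _ ≤ l (fderiv ℝ τ y (z - y)) + _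
  linarith

end Euclidean

/-! ### Semi-concavity on a manifold, checked in one chart around each point. -/

section Manifold

variable {n : ℕ} {M : Type*} [TopologicalSpace M] [ChartedSpace (EuclideanSpace ℝ (Fin n)) M]
  {f g : M → ℝ}

theorem isLocallySemiConcave_of_exists_chart [IsManifold (𝓡 n) ∞ M]
    (h : ∀ x : M, ∃ e ∈ IsManifold.maximalAtlas (𝓡 n) ∞ M, x ∈ e.source ∧
      ∃ w : ℝ≥0 → ℝ≥0, IsModulus w ∧ SemiConcaveOnWith w (f ∘ e.symm) e.target) :
    IsLocallySemiConcave n f := by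
  intro e he u hu
  obtain ⟨e', he', hx, w, hw, hf⟩ := h (e.symm u)
  have hτ : ContDiffAt ℝ 2 (e' ∘ e.symm) u := by
    have h1 := (contMDiffAt_of_mem_maximalAtlas he' hx).comp u
      (contMDiffAt_symm_of_mem_maximalAtlas he hu)
    exact (contMDiffAt_iff_contDiffAt.1 h1).of_le (WithTop.coe_le_coe.2 le_top)
  obtain ⟨r, hr, w', hw', hcomp⟩ :=
    hf.comp_contDiffAt hw e'.open_target hτ (e'.map_source hx)
  have hopen : IsOpen (e.target ∩ e.symm ⁻¹' e'.source) :=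
    e.symm.isOpen_inter_preimage e'.open_source
  refine ⟨Metric.ball u r ∩ (e.target ∩ e.symm ⁻¹' e'.source), Metric.isOpen_ball.inter hopen,
    ⟨Metric.mem_ball_self hr, hu, hx⟩, fun v hv => hv.2.1, w', hw',
    (hcomp.mono inter_subset_left).congr fun v hv => ?_⟩
  simp [e'.left_inv hv.2.2]

theorem IsLocallySemiConcave.min (hf : IsLocallySemiConcave n f) (hg : IsLocallySemiConcave n g) :
    IsLocallySemiConcave n (fun x => min (f x) (g x)) :=
  fun e he => (hf e he).min (hg e he)

theorem IsLocallySemiConcave.continuous [IsManifold (𝓡 n) ∞ M] (hf : IsLocallySemiConcave n f) :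
    Continuous f := by
  refine continuous_iff_continuousAt.2 fun x => ?_
  have he := IsManifold.chart_mem_maximalAtlas (I := 𝓡 n) (n := ∞) x
  have hx := mem_chart_source (EuclideanSpace ℝ (Fin n)) x
  have h1 := (hf _ he).continuousAt ((chartAt _ x).map_source hx)
  have h2 := h1.comp ((chartAt (EuclideanSpace ℝ (Fin n)) x).continuousAt hx)
  refine h2.congr ?_
  filter_upwards [(chartAt (EuclideanSpace ℝ (Fin n)) x).open_source.mem_nhds hx] with y hy
  simp [(chartAt (EuclideanSpace ℝ (Fin n)) x).left_inv hy]

end Manifold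

/-! ### Measurability of the partial derivative and of its domain. -/

section Parametric

variable {n : ℕ}

/-- Expresses differentiability by countably many conditions. Conversely, continuity extends the
estimates from the dense increments to all small ones; comparing two of them on a neighbourhood of
`0` shows that the approximate derivatives `L (i m)` form a Cauchy sequence, whose limit is the
derivative. -/
theorem differentiableAt_iff_dense {f : EuclideanSpace ℝ (Fin n) → ℝ}
    {U : Set (EuclideanSpace ℝ (Fin n))} (hU : IsOpen U) (hf : ContinuousOn f U)
    {x : EuclideanSpace ℝ (Fin n)} (hx : x ∈ U) {d : ℕ → EuclideanSpace ℝ (Fin n)}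
    (hd : DenseRange d) {L : ℕ → EuclideanSpace ℝ (Fin n) →L[ℝ] ℝ} (hL : DenseRange L) :
    DifferentiableAt ℝ f x ↔ ∀ m : ℕ, ∃ i j : ℕ, ∀ k : ℕ, ‖d k‖ < 1 / ((j : ℝ) + 1) →
      |f (x + d k) - f x - L i (d k)| ≤ 1 / ((m : ℝ) + 1) * ‖d k‖ := by
  constructor
  · intro h m
    have hε : (0 : ℝ) < 1 / ((m : ℝ) + 1) / 2 := by positivity
    obtain ⟨i, hi⟩ := hL.exists_dist_lt (fderiv ℝ f x) hε
    rw [dist_eq_norm] at hi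
    have h1 := Asymptotics.isLittleO_iff.1 (hasFDerivAt_iff_isLittleO_nhds_zero.1 h.hasFDerivAt) hε
    obtain ⟨δ, hδ, hball⟩ := Metric.eventually_nhds_iff_ball.1 h1
    obtain ⟨j, hj⟩ := exists_nat_one_div_lt hδ
    refine ⟨i, j, fun k hk => ?_⟩
    have h2 := hball (d k) (by simpa using hk.trans hj)
    rw [Real.norm_eq_abs] at h2
    have h3 : |(fderiv ℝ f x - L i) (d k)| ≤ 1 / ((m : ℝ) + 1) / 2 * ‖d k‖ :=
      ((fderiv ℝ f x - L i).le_opNorm _).trans (by gcongr)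
    rw [sub_apply] at h3
    calc |f (x + d k) - f x - L i (d k)|
        = |(f (x + d k) - f x - fderiv ℝ f x (d k)) + (fderiv ℝ f x (d k) - L i (d k))| := by
          congr 1; ring
      _ ≤ _ := abs_add_le _ _
      _ ≤ _ := by linarith
  · intro h
    choose i j hij using h
    have hev : ∀ m : ℕ, ∀ᶠ v in 𝓝 (0 : EuclideanSpace ℝ (Fin n)),
        |f (x + v) - f x - L (i m) v| ≤ 1 / ((m : ℝ) + 1) * ‖v‖ := by
      intro m
      have hopen : IsOpen (Metric.ball (0 : EuclideanSpace ℝ (Fin n)) (1 / ((j m : ℝ) + 1)) ∩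
          (fun v => x + v) ⁻¹' U) := Metric.isOpen_ball.inter (hU.preimage (by fun_prop))
      have hmem : (0 : EuclideanSpace ℝ (Fin n)) ∈
          Metric.ball (0 : EuclideanSpace ℝ (Fin n)) (1 / ((j m : ℝ) + 1)) ∩
          (fun v => x + v) ⁻¹' U := ⟨Metric.mem_ball_self (by positivity), by simpa using hx⟩
      filter_upwards [hopen.mem_nhds hmem] with v hv
      have hcl := hd.open_subset_closure_inter hopen hv
      obtain ⟨s, hs, hlim⟩ := mem_closure_iff_seq_limit.1 hcl
      have hcont : Tendsto (fun k => f (x + s k)) atTop (𝓝 (f (x + v))) :=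
        (hf.continuousAt (hU.mem_nhds hv.2)).tendsto.comp (hlim.const_add x)
      have hlin : Tendsto (fun k => L (i m) (s k)) atTop (𝓝 (L (i m) v)) :=
        ((L (i m)).continuous.tendsto v).comp hlim
      refine le_of_tendsto_of_tendsto' ((hcont.sub_const (f x)).sub hlin).abs
        (hlim.norm.const_mul (1 / ((m : ℝ) + 1))) fun k => ?_
      obtain ⟨hk, q, hq⟩ := hs k
      have h1 := hij m q
      rw [hq] at h1
      exact h1 (by simpa using hk.1)
    have hdist : ∀ m m' : ℕ, ‖L (i m) - L (i m')‖ ≤ 1 / ((m : ℝ) + 1) + 1 / ((m' : ℝ) + 1) := by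
      intro m m'
      refine ContinuousLinearMap.opNorm_le_of_nhds_zero (by positivity) ?_
      filter_upwards [hev m, hev m'] with v hv hv'
      rw [sub_apply, Real.norm_eq_abs]
      calc |L (i m) v - L (i m') v|
          = |(f (x + v) - f x - L (i m') v) - (f (x + v) - f x - L (i m) v)| := by
            congr 1; ring
        _ ≤ _ := abs_sub _ _
        _ ≤ _ := by linarith
    have hcauchy : CauchySeq fun m => L (i m) := by
      refine cauchySeq_of_le_tendsto_0 (fun m : ℕ => 1 / ((m : ℝ) + 1) + 1 / ((m : ℝ) + 1))
        (fun m m' N hm hm' => ?_) ?_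
      · rw [dist_eq_norm]
        refine (hdist m m').trans ?_
        gcongr
      · simpa using tendsto_one_div_add_atTop_nhds_zero_nat (𝕜 := ℝ).add
          (tendsto_one_div_add_atTop_nhds_zero_nat (𝕜 := ℝ))
    obtain ⟨l, hl⟩ := cauchySeq_tendsto_of_complete hcauchy
    refine HasFDerivAt.differentiableAt (f' := l) ?_
    rw [hasFDerivAt_iff_isLittleO_nhds_zero, Asymptotics.isLittleO_iff]
    intro ε hε
    have h1 := (tendsto_iff_norm_sub_tendsto_zero.1 hl).eventually_lt_const (half_pos hε)
    have h2 := (tendsto_one_div_add_atTop_nhds_zero_nat (𝕜 := ℝ)).eventually_lt_const (half_pos hε)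
    obtain ⟨m, hm1, hm2⟩ := (h1.and h2).exists
    filter_upwards [hev m] with v hv
    have h3 : |(L (i m) - l) v| ≤ ε / 2 * ‖v‖ :=
      ((L (i m) - l).le_opNorm _).trans (by gcongr)
    have h4 : 1 / ((m : ℝ) + 1) * ‖v‖ ≤ ε / 2 * ‖v‖ := by gcongr
    rw [sub_apply] at h3
    rw [Real.norm_eq_abs]
    calc |f (x + v) - f x - l v|
        = |(f (x + v) - f x - L (i m) v) + (L (i m) v - l v)| := by congr 1; ring
      _ ≤ _ := abs_add_le _ _
      _ ≤ _ := by linarith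

variable {N : Type*} [MeasurableSpace N] {F : EuclideanSpace ℝ (Fin n) × N → ℝ}
  {U : Set (EuclideanSpace ℝ (Fin n))}

/-- The points of `U × N` at which a function is differentiable in its first variable. -/
def diffDomain (F : EuclideanSpace ℝ (Fin n) × N → ℝ) (U : Set (EuclideanSpace ℝ (Fin n))) :
    Set (EuclideanSpace ℝ (Fin n) × N) :=
  {p | p.1 ∈ U ∧ DifferentiableAt ℝ (fun u => F (u, p.2)) p.1}

theorem measurableSet_diffDomain (hF : Measurable F) (hU : IsOpen U)
    (hcont : ∀ y, ContinuousOn (fun u => F (u, y)) U) : MeasurableSet (diffDomain F U) := by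
  let d := TopologicalSpace.denseSeq (EuclideanSpace ℝ (Fin n))
  have hd : DenseRange d := TopologicalSpace.denseRange_denseSeq _
  let D := InnerProductSpace.toDual ℝ (EuclideanSpace ℝ (Fin n))
  have hD : DenseRange fun i => (D (d i) : EuclideanSpace ℝ (Fin n) →L[ℝ] ℝ) :=
    D.surjective.denseRange.comp hd D.continuous
  have : diffDomain F U = Prod.fst ⁻¹' U ∩ ⋂ m : ℕ, ⋃ i : ℕ, ⋃ j : ℕ, ⋂ k : ℕ,
      {p | ‖d k‖ < 1 / ((j : ℝ) + 1) →
        |F (p.1 + d k, p.2) - F p - D (d i) (d k)| ≤ 1 / ((m : ℝ) + 1) * ‖d k‖} := by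
    ext ⟨u, y⟩
    simp only [diffDomain, mem_ofPred_eq, mem_inter_iff, mem_preimage, mem_iInter, mem_iUnion]
    refine and_congr_right fun hu => ?_
    exact differentiableAt_iff_dense hU (hcont y) hu hd hD
  rw [this]
  refine (measurable_fst hU.measurableSet).inter (MeasurableSet.iInter fun m =>
    MeasurableSet.iUnion fun i => MeasurableSet.iUnion fun j => MeasurableSet.iInter fun k => ?_)
  refine MeasurableSet.imp (MeasurableSet.const _) (measurableSet_le ?_ measurable_const)
  have h1 : Measurable fun p : EuclideanSpace ℝ (Fin n) × N => F (p.1 + d k, p.2) :=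
    hF.comp (by fun_prop)
  exact measurable_abs.comp ((h1.sub hF).sub measurable_const)

theorem measurable_indicator_fderiv (hF : Measurable F) (hU : IsOpen U)
    (hcont : ∀ y, ContinuousOn (fun u => F (u, y)) U) (v : EuclideanSpace ℝ (Fin n)) :
    Measurable ((diffDomain F U).indicator
      fun p => fderiv ℝ (fun u => F (u, p.2)) p.1 v) := by
  refine measurable_of_tendsto_metrizable (f := fun (m : ℕ) => (diffDomain F U).indicator
    fun p => (m : ℝ) • (F (p.1 + (m : ℝ)⁻¹ • v, p.2) - F p)) (fun m => ?_) ?_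
  · have h1 : Measurable fun p : EuclideanSpace ℝ (Fin n) × N => F (p.1 + (m : ℝ)⁻¹ • v, p.2) :=
      hF.comp (by fun_prop)
    exact ((h1.sub hF).const_smul (m : ℝ)).indicator (measurableSet_diffDomain hF hU hcont)
  · rw [tendsto_pi_nhds]
    intro p
    by_cases hp : p ∈ diffDomain F U
    · simp only [indicator_of_mem hp]
      exact hp.2.hasFDerivAt.lim v
        (by simpa using tendsto_natCast_atTop_atTop (R := ℝ))
    · simp [indicator_of_notMem hp]

end Parametric

/-! ### Differentiability forced by contact with a differentiable function. -/

section Euclidean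

/-- Minimality bounds `f` below by a constant minus `g`, semi-concavity bounds it above by an affine
function plus a negligible term. Both bounds touch `f` at `x` and are differentiable there, so their
derivatives agree and `f` inherits the common value. -/
theorem SemiConcaveOnWith.hasFDerivAt_neg_of_isLocalMin_add {n : ℕ} {w : ℝ≥0 → ℝ≥0}
    {f g : EuclideanSpace ℝ (Fin n) → ℝ} {U : Set (EuclideanSpace ℝ (Fin n))}
    {x : EuclideanSpace ℝ (Fin n)} {g' : EuclideanSpace ℝ (Fin n) →L[ℝ] ℝ} (hw : IsModulus w)
    (hf : SemiConcaveOnWith w f U) (hU : U ∈ 𝓝 x) (hg : HasFDerivAt g g' x)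
    (hmin : IsLocalMin (fun y => f y + g y) x) : HasFDerivAt f (-g') x := by
  obtain ⟨l, hl⟩ := hf x (mem_of_mem_nhds hU)
  have hrem : HasFDerivAt (fun y => ‖y - x‖ * (w ‖y - x‖₊ : ℝ))
      (0 : EuclideanSpace ℝ (Fin n) →L[ℝ] ℝ) x := by
    rw [hasFDerivAt_iff_isLittleO, Asymptotics.isLittleO_iff]
    intro ε hε
    filter_upwards [(hw.tendsto_nnnorm_sub x).eventually_lt_const hε] with y hy
    simp only [sub_self, norm_zero, zero_mul, sub_zero, zero_apply, norm_mul, norm_norm]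
    rw [mul_comm, Real.norm_of_nonneg (NNReal.coe_nonneg _)]
    gcongr
  have hlin : HasFDerivAt (fun y => l (y - x)) l x := by
    exact l.hasFDerivAt.comp x ((hasFDerivAt_id x).sub_const x)
  have hup : HasFDerivAt (fun y => f x + (l (y - x) + ‖y - x‖ * (w ‖y - x‖₊ : ℝ))) l x := by
    simpa using (hlin.add hrem).const_add (f x)
  have hlow : HasFDerivAt (fun y => f x + g x - g y) (-g') x := by
    simpa using hg.const_sub (f x + g x)
  have hle : ∀ᶠ y in 𝓝 x, f x + g x - g y ≤ f y := by
    filter_upwards [hmin] with y hy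
    linarith [hy]
  have hle' : ∀ᶠ y in 𝓝 x, f y ≤ f x + (l (y - x) + ‖y - x‖ * (w ‖y - x‖₊ : ℝ)) := by
    filter_upwards [hU] with y hy
    linarith [hl y hy]
  have hl' : l = -g' := by
    have h1 : IsLocalMin (fun y => (f x + (l (y - x) + ‖y - x‖ * (w ‖y - x‖₊ : ℝ))) -
        (f x + g x - g y)) x := by
      filter_upwards [hle, hle'] with y hy hy'
      simp only [sub_self, map_zero, norm_zero, zero_mul, add_zero]
      linarith
    exact sub_eq_zero.1 (h1.hasFDerivAt_eq_zero (hup.sub hlow))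
  rw [hl'] at hup hle'
  rw [hasFDerivAt_iff_isLittleO, Asymptotics.isLittleO_iff] at hup hlow ⊢
  intro ε hε
  filter_upwards [hup hε, hlow hε, hle, hle'] with y h1 h2 h3 h4
  simp only [sub_self, map_zero, norm_zero, zero_mul, add_zero, Real.norm_eq_abs] at h1 h2 ⊢
  rw [abs_le] at h1 h2 ⊢
  constructor <;> linarith [h1.1, h1.2, h2.1, h2.2]

end Euclidean

theorem measurableSet_source_inter_preimage {n : ℕ} {M : Type*} [TopologicalSpace M]
    [MeasurableSpace M] [BorelSpace M] (e : OpenPartialHomeomorph M (EuclideanSpace ℝ (Fin n)))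
    {B : Set (EuclideanSpace ℝ (Fin n))} (hB : MeasurableSet B) :
    MeasurableSet (e.source ∩ e ⁻¹' B) := by
  have h1 : Measurable (e.source.domRestrict e) :=
    (continuousOn_iff_continuous_domRestrict.1 e.continuousOn).measurable
  have h2 := e.open_source.measurableSet.subtype_image (h1 hB)
  convert h2 using 1
  ext x
  simp [and_comm]

/-! ### Differentials on the manifold, computed in charts. -/

section Manifold

variable {n : ℕ} {M : Type*} [TopologicalSpace M] [ChartedSpace (EuclideanSpace ℝ (Fin n)) M]
  {f g : M → ℝ} {x : M}
  {e : OpenPartialHomeomorph M (EuclideanSpace ℝ (Fin n))}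

theorem diffAt_iff_differentiableAt (he : e ∈ IsManifold.maximalAtlas (𝓡 n) ∞ M)
    (hx : x ∈ e.source) : DiffAt n f x ↔ DifferentiableAt ℝ (f ∘ e.symm) (e x) := by
  have h1 := (contMDiffAt_of_mem_maximalAtlas he hx).mdifferentiableAt (by simp)
  have h2 := (contMDiffAt_symm_of_mem_maximalAtlas he (e.map_source hx)).mdifferentiableAt
    (by simp)
  constructor
  · intro h
    refine mdifferentiableAt_iff_differentiableAt.1 (MDifferentiableAt.comp (e x) ?_ h2)
    rwa [e.left_inv hx]
  · intro h
    have h3 : MDifferentiableAt (𝓡 n) 𝓘(ℝ, ℝ) ((f ∘ e.symm) ∘ e) x :=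
      (mdifferentiableAt_iff_differentiableAt.2 h).comp x h1
    refine h3.congr_of_eventuallyEq ?_
    filter_upwards [e.open_source.mem_nhds hx] with y hy
    simp [e.left_inv hy]

theorem differential_eq_fderiv_comp (he : e ∈ IsManifold.maximalAtlas (𝓡 n) ∞ M)
    (hx : x ∈ e.source) (hf : DiffAt n f x) (t : TangentSpace (𝓡 n) x) :
    differential n f x t = fderiv ℝ (f ∘ e.symm) (e x) (mfderiv (𝓡 n) (𝓡 n) e x t) := by
  have h1 := (contMDiffAt_of_mem_maximalAtlas he hx).mdifferentiableAt (by simp)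
  have h2 := mdifferentiableAt_iff_differentiableAt.2 ((diffAt_iff_differentiableAt he hx).1 hf)
  have h3 := mfderiv_comp x h2 h1
  have h4 : mfderiv (𝓡 n) 𝓘(ℝ, ℝ) f x = mfderiv (𝓡 n) 𝓘(ℝ, ℝ) ((f ∘ e.symm) ∘ e) x := by
    refine Filter.EventuallyEq.mfderiv_eq ?_
    filter_upwards [e.open_source.mem_nhds hx] with y hy
    simp [e.left_inv hy]
  refine (congrArg (fun T : EuclideanSpace ℝ (Fin n) →L[ℝ] ℝ => T t) (h4.trans h3)).trans ?_
  rw [mfderiv_eq_fderiv]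
  rfl

theorem differential_eq_neg_iff (he : e ∈ IsManifold.maximalAtlas (𝓡 n) ∞ M)
    (hx : x ∈ e.source) (hf : DiffAt n f x) (hg : DiffAt n g x) :
    differential n f x = -differential n g x ↔
      fderiv ℝ (f ∘ e.symm) (e x) = -fderiv ℝ (g ∘ e.symm) (e x) := by
  have hdiff : e.MDifferentiable (𝓡 n) (𝓡 n) :=
    ⟨(contMDiffOn_of_mem_maximalAtlas he).mdifferentiableOn (by simp),
      (contMDiffOn_symm_of_mem_maximalAtlas he).mdifferentiableOn (by simp)⟩
  constructor
  · intro h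
    ext v
    obtain ⟨t, ht⟩ := hdiff.mfderiv_surjective hx v
    have h1 := differential_eq_fderiv_comp he hx hf t
    have h2 := differential_eq_fderiv_comp he hx hg t
    rw [ht] at h1 h2
    rw [neg_apply, ← h1, ← h2, h, neg_apply]
  · intro h
    ext t
    rw [neg_apply, differential_eq_fderiv_comp he hx hf, differential_eq_fderiv_comp he hx hg, h]
    rfl

theorem differential_eq_neg_of_isLocalMin_add [IsManifold (𝓡 n) ∞ M]
    (hf : IsLocallySemiConcave n f) (hg : DiffAt n g x)
    (hmin : ∀ z, f x + g x ≤ f z + g z) :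
    DiffAt n f x ∧ differential n f x = -differential n g x := by
  have he := IsManifold.chart_mem_maximalAtlas (I := 𝓡 n) (n := ∞) x
  have hx := mem_chart_source (EuclideanSpace ℝ (Fin n)) x
  set e := chartAt (EuclideanSpace ℝ (Fin n)) x
  obtain ⟨V, hV, hxV, -, w, hw, hfV⟩ := hf e he (e x) (e.map_source hx)
  have h1 := hfV.hasFDerivAt_neg_of_isLocalMin_add hw (hV.mem_nhds hxV)
    ((diffAt_iff_differentiableAt he hx).1 hg).hasFDerivAt
    (Eventually.of_forall fun v => by simpa [e.left_inv hx] using hmin (e.symm v))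
  have h2 := (diffAt_iff_differentiableAt he hx).2 h1.differentiableAt
  exact ⟨h2, (differential_eq_neg_iff he hx h2 hg).2 h1.fderiv⟩

theorem differential_eq_of_le_of_eq [IsManifold (𝓡 n) ∞ M]
    (hf : DiffAt n f x) (hg : DiffAt n g x) (hle : ∀ z, f z ≤ g z)
    (heq : f x = g x) : differential n g x = differential n f x := by
  have he := IsManifold.chart_mem_maximalAtlas (I := 𝓡 n) (n := ∞) x
  have hx := mem_chart_source (EuclideanSpace ℝ (Fin n)) x
  set e := chartAt (EuclideanSpace ℝ (Fin n)) x
  have h1 := ((diffAt_iff_differentiableAt he hx).1 hf).hasFDerivAt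
  have h2 := ((diffAt_iff_differentiableAt he hx).1 hg).hasFDerivAt
  have hmin : IsLocalMin (fun v => (g ∘ e.symm) v - (f ∘ e.symm) v) (e x) :=
    Eventually.of_forall fun v => by
      simpa [e.left_inv hx, heq] using hle (e.symm v)
  have h3 := sub_eq_zero.1 (hmin.hasFDerivAt_eq_zero (h2.sub h1))
  ext t
  rw [differential_eq_fderiv_comp he hx hf, differential_eq_fderiv_comp he hx hg, h3]

theorem IsLocallySemiConcave.isCountablyLipschitz (hf : IsLocallySemiConcave n f) :
    IsCountablyLipschitz n {x | ¬ DiffAt n f x} := by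
  intro e he
  refine (hf e he).countablyLipschitz.mono ?_
  rintro _ ⟨x, ⟨hx, hxe⟩, rfl⟩
  exact ⟨e.map_source hxe, fun h => hx ((diffAt_iff_differentiableAt he hxe).2 h)⟩

theorem IsCountablyLipschitz.iUnion {ι : Type*} [Countable ι] {S : ι → Set M}
    (hS : ∀ i, IsCountablyLipschitz n (S i)) : IsCountablyLipschitz n (⋃ i, S i) := by
  intro e he
  rw [iUnion_inter, image_iUnion]
  exact CountablyLipschitz.iUnion fun i => hS i e he

theorem diffAt_neg_iff [IsManifold (𝓡 n) ∞ M] : DiffAt n (fun z => -f z) x ↔ DiffAt n f x := by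
  have he := IsManifold.chart_mem_maximalAtlas (I := 𝓡 n) (n := ∞) x
  have hx := mem_chart_source (EuclideanSpace ℝ (Fin n)) x
  rw [diffAt_iff_differentiableAt he hx, diffAt_iff_differentiableAt he hx]
  exact differentiableAt_neg_iff

variable (n) in
theorem measurableSet_of_forall_chart [MeasurableSpace M] [SecondCountableTopology M]
    {S : Set M}
    (hS : ∀ x : M, MeasurableSet (S ∩ (chartAt (EuclideanSpace ℝ (Fin n)) x).source)) :
    MeasurableSet S := by
  obtain ⟨T, hT, hTU⟩ := TopologicalSpace.isOpen_iUnion_countable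
    (fun x : M => (chartAt (EuclideanSpace ℝ (Fin n)) x).source) fun x => (chartAt _ x).open_source
  have : S = ⋃ x ∈ T, S ∩ (chartAt (EuclideanSpace ℝ (Fin n)) x).source := by
    rw [← inter_iUnion₂, hTU, iUnion_source_chartAt, inter_univ]
  rw [this]
  exact MeasurableSet.biUnion hT fun x _ => hS x

theorem measurableSet_diffAt [IsManifold (𝓡 n) ∞ M] [MeasurableSpace M] [BorelSpace M]
    [SecondCountableTopology M] (f : M → ℝ) :
    MeasurableSet {x | DiffAt n f x} := by
  refine measurableSet_of_forall_chart n fun x => ?_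
  set e := chartAt (EuclideanSpace ℝ (Fin n)) x
  convert measurableSet_source_inter_preimage e
    (measurableSet_of_differentiableAt ℝ (f ∘ e.symm)) using 1
  ext z
  rw [inter_comm]
  exact and_congr_right fun hz =>
    diffAt_iff_differentiableAt (IsManifold.chart_mem_maximalAtlas x) hz

end Manifold

/-! ### The inverse Legendre transform and its Borel measurability. -/

section Legendre

variable {n : ℕ} {M : Type*} [TopologicalSpace M] [ChartedSpace (EuclideanSpace ℝ (Fin n)) M]
  {N : Type*} {c : M × N → ℝ} {x : M} {y : N} {p : CotangentSpace n x}

theorem legendreInv_of_mem (hc : LeftTwist n c) (y₀ : N) (hxy : (x, y) ∈ legendreDomain n c)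
    (h : partialDeriv n c x y = p) : legendreInv n c y₀ ⟨x, p⟩ = (x, y) := by
  have hmk : legendre n c (x, y) = ⟨x, p⟩ := by rw [← h]; rfl
  have hex : ∃ q ∈ legendreDomain n c, legendre n c q = ⟨x, p⟩ := ⟨(x, y), hxy, hmk⟩
  rw [legendreInv, dif_pos hex]
  exact hc hex.choose_spec.1 hxy (hex.choose_spec.2.trans hmk.symm)

theorem legendreInv_of_forall_ne (y₀ : N)
    (h : ∀ y, (x, y) ∈ legendreDomain n c → partialDeriv n c x y ≠ p) :
    legendreInv n c y₀ ⟨x, p⟩ = (x, y₀) := by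
  rw [legendreInv, dif_neg]
  rintro ⟨⟨x', y⟩, hxy, heq⟩
  obtain rfl : x' = x := congrArg Bundle.TotalSpace.proj heq
  exact h y hxy ((Bundle.TotalSpace.mk_inj ..).1 heq)

theorem legendreInv_fst (hc : LeftTwist n c) (y₀ : N) : (legendreInv n c y₀ ⟨x, p⟩).1 = x := by
  by_cases h : ∃ y, (x, y) ∈ legendreDomain n c ∧ partialDeriv n c x y = p
  · obtain ⟨y, hxy, hp⟩ := h
    rw [legendreInv_of_mem hc y₀ hxy hp]
  · push Not at h
    rw [legendreInv_of_forall_ne y₀ h]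

/-- Both alternatives have the form "some `y ∈ A` realises `p`", with `A = B` or `A = univ`, so that
one statement about images of Borel sets handles both. -/
theorem legendreInv_snd_mem_iff (hc : LeftTwist n c) (y₀ : N) (B : Set N) :
    (legendreInv n c y₀ ⟨x, p⟩).2 ∈ B ↔
      (∃ y ∈ B, (x, y) ∈ legendreDomain n c ∧ partialDeriv n c x y = p) ∨
      (¬ ∃ y ∈ univ, (x, y) ∈ legendreDomain n c ∧ partialDeriv n c x y = p) ∧ y₀ ∈ B := by
  by_cases h : ∃ y, (x, y) ∈ legendreDomain n c ∧ partialDeriv n c x y = p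
  · obtain ⟨y, hxy, hp⟩ := h
    rw [legendreInv_of_mem hc y₀ hxy hp]
    constructor
    · exact fun hy => Or.inl ⟨y, hy, hxy, hp⟩
    · rintro (⟨y', hy', hxy', hp'⟩ | ⟨h, -⟩)
      · have := (legendreInv_of_mem hc y₀ hxy hp).symm.trans (legendreInv_of_mem hc y₀ hxy' hp')
        rwa [(Prod.mk.inj this).2]
      · exact absurd ⟨y, mem_univ y, hxy, hp⟩ h
  · have h' := h
    push Not at h
    rw [legendreInv_of_forall_ne y₀ h]
    constructor
    · exact fun hy => Or.inr ⟨fun ⟨y, _, hy⟩ => h' ⟨y, hy⟩, hy⟩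
    · rintro (⟨y, -, hy⟩ | ⟨-, hy⟩)
      · exact absurd ⟨y, hy⟩ h'
      · exact hy

/-- In a chart, `Φ` is the Legendre transform in coordinates and `H` the section given by `-dg`. The
twist condition makes `Φ` injective on its Borel domain `D`, so images of Borel sets under it are
Borel, and the set in question is obtained by pulling them back along `H`. -/
theorem measurableSet_legendreInv_snd_mem [IsManifold (𝓡 n) ∞ M] [SecondCountableTopology M]
    [MeasurableSpace M] [BorelSpace M] [MeasurableSpace N] [StandardBorelSpace N]
    (hc_meas : Measurable c) (hc_conc : ∀ y, IsLocallySemiConcave n fun x => c (x, y))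
    (hc : LeftTwist n c) (y₀ : N) (g : M → ℝ) {B : Set N} (hB : MeasurableSet B) :
    MeasurableSet {x | DiffAt n g x ∧
      (legendreInv n c y₀ ⟨x, -differential n g x⟩).2 ∈ B} := by
  refine measurableSet_of_forall_chart n fun x₀ => ?_
  have he := IsManifold.chart_mem_maximalAtlas (I := 𝓡 n) (n := ∞) x₀
  set e := chartAt (EuclideanSpace ℝ (Fin n)) x₀
  classical
  -- Extending the inverse chart by the constant `x₀` off its target makes `F` Borel on the whole
  -- product; only its values on the target matter.
  let σ : EuclideanSpace ℝ (Fin n) → M := e.target.piecewise e.symm fun _ => x₀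
  have hσ : Measurable σ := ContinuousOn.measurable_piecewise e.continuousOn_symm
    continuousOn_const e.open_target.measurableSet
  have hσe : EqOn σ e.symm e.target := piecewise_eqOn _ _ _
  let F : EuclideanSpace ℝ (Fin n) × N → ℝ := fun p => c (σ p.1, p.2)
  have hF : Measurable F := hc_meas.comp (by fun_prop)
  have hFe : ∀ y, EqOn (fun u => F (u, y)) ((fun x => c (x, y)) ∘ e.symm) e.target := by
    intro y u hu
    simp [F, hσe hu]
  have hFcont : ∀ y, ContinuousOn (fun u => F (u, y)) e.target := fun y =>
    (continuousOn_of_forall_continuousAt fun u hu =>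
      (hc_conc y e he).continuousAt hu).congr (hFe y)
  have hFev : ∀ y, ∀ u ∈ e.target,
      (fun u => F (u, y)) =ᶠ[𝓝 u] (fun x => c (x, y)) ∘ e.symm := fun y u hu =>
    (hFe y).eventuallyEq_of_mem (e.open_target.mem_nhds hu)
  set D := diffDomain F e.target
  have hDmeas : MeasurableSet D := measurableSet_diffDomain hF e.open_target hFcont
  have hDiff : ∀ z ∈ e.source, ∀ y, (e z, y) ∈ D ↔ (z, y) ∈ legendreDomain n c := by
    intro z hz y
    have h1 : (z, y) ∈ legendreDomain n c ↔ _ := diffAt_iff_differentiableAt he hz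
    rw [h1, ← (hFev y _ (e.map_source hz)).differentiableAt_iff]
    exact and_iff_right (e.map_source hz)
  let b := (EuclideanSpace.basisFun (Fin n) ℝ).toBasis
  have hb : ∀ l l' : EuclideanSpace ℝ (Fin n) →L[ℝ] ℝ, (∀ i, l (b i) = l' (b i)) → l = l' :=
    fun l l' h => ContinuousLinearMap.coe_injective (b.ext h)
  let Φ : EuclideanSpace ℝ (Fin n) × N → EuclideanSpace ℝ (Fin n) × (Fin n → ℝ) := fun p =>
    (p.1, fun i => D.indicator (fun p => fderiv ℝ (fun u => F (u, p.2)) p.1 (b i)) p)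
  have hΦ : Measurable Φ := measurable_fst.prodMk (measurable_pi_lambda _ fun i =>
    measurable_indicator_fderiv hF e.open_target hFcont (b i))
  have hΦD : ∀ z ∈ e.source, ∀ y, (e z, y) ∈ D → ∀ i,
      (Φ (e z, y)).2 i = fderiv ℝ ((fun x => c (x, y)) ∘ e.symm) (e z) (b i) := by
    intro z hz y hy i
    simp only [Φ, indicator_of_mem hy]
    rw [(hFev y _ (e.map_source hz)).fderiv_eq]
  have hΦinj : InjOn Φ D := by
    rintro ⟨u, y⟩ hy ⟨u', y'⟩ hy' heq
    obtain rfl : u = u' := congrArg Prod.fst heq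
    obtain ⟨z, hz, rfl⟩ : ∃ z ∈ e.source, e z = u :=
      ⟨e.symm u, e.map_target hy.1, e.right_inv hy.1⟩
    have h1 := (hDiff _ hz y).1 hy
    have h2 := (hDiff _ hz y').1 hy'
    have h3 : fderiv ℝ ((fun x => c (x, y)) ∘ e.symm) (e z) =
        fderiv ℝ ((fun x => c (x, y')) ∘ e.symm) (e z) := by
      refine hb _ _ fun i => ?_
      rw [← hΦD _ hz y hy, ← hΦD _ hz y' hy', heq]
    have h4 : partialDeriv n c z y = partialDeriv n c z y' := by
      ext t
      refine (differential_eq_fderiv_comp he hz h1 t).trans ?_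
      rw [h3]
      exact (differential_eq_fderiv_comp he hz h2 t).symm
    have h5 : (z, y) = (z, y') :=
      hc h1 h2 (congrArg (Bundle.TotalSpace.mk z) h4)
    rw [(Prod.mk.inj h5).2]
  let H : EuclideanSpace ℝ (Fin n) → EuclideanSpace ℝ (Fin n) × (Fin n → ℝ) := fun u =>
    (u, fun i => -fderiv ℝ (g ∘ e.symm) u (b i))
  have hH : Measurable H := measurable_id.prodMk (measurable_pi_lambda _ fun i =>
    (measurable_fderiv_apply_const ℝ (g ∘ e.symm) (b i)).neg)
  let X : Set N → Set (EuclideanSpace ℝ (Fin n)) := fun A => H ⁻¹' (Φ '' (D ∩ Prod.snd ⁻¹' A))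
  have hX : ∀ A, MeasurableSet A → MeasurableSet (X A) := fun A hA =>
    hH ((hDmeas.inter (measurable_snd hA)).image_of_measurable_injOn hΦ
      (hΦinj.mono inter_subset_left))
  have hXiff : ∀ z ∈ e.source, DiffAt n g z → ∀ A, e z ∈ X A ↔
      ∃ y ∈ A, (z, y) ∈ legendreDomain n c ∧ partialDeriv n c z y = -differential n g z := by
    intro z hz hg A
    constructor
    · rintro ⟨⟨u, y⟩, ⟨hy, hyA⟩, heq⟩
      obtain rfl : u = e z := congrArg Prod.fst heq
      have h1 := (hDiff z hz y).1 hy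
      refine ⟨y, hyA, h1, (differential_eq_neg_iff he hz h1 hg).2 (hb _ _ fun i => ?_)⟩
      have h2 := congrFun (congrArg Prod.snd heq) i
      rw [hΦD z hz y hy] at h2
      exact h2
    · rintro ⟨y, hyA, h1, h2⟩
      have hy := (hDiff z hz y).2 h1
      refine ⟨(e z, y), ⟨hy, hyA⟩, Prod.ext rfl (funext fun i => ?_)⟩
      rw [hΦD z hz y hy, (differential_eq_neg_iff he hz h1 hg).1 h2]
      rfl
  have hset : {x | DiffAt n g x ∧ (legendreInv n c y₀ ⟨x, -differential n g x⟩).2 ∈ B} ∩ e.source =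
      {x | DiffAt n g x} ∩ (e.source ∩ e ⁻¹' (X B ∪ ((X univ)ᶜ ∩ {_u | y₀ ∈ B}))) := by
    ext z
    constructor
    · rintro ⟨⟨hg, hz⟩, hze⟩
      refine ⟨hg, hze, ?_⟩
      rw [legendreInv_snd_mem_iff hc, ← hXiff z hze hg, ← hXiff z hze hg] at hz
      exact hz
    · rintro ⟨hg, hze, hz⟩
      refine ⟨⟨hg, ?_⟩, hze⟩
      rw [legendreInv_snd_mem_iff hc, ← hXiff z hze hg, ← hXiff z hze hg]
      exact hz
  rw [hset]
  exact (measurableSet_diffAt g).inter (measurableSet_source_inter_preimage e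
    ((hX B hB).union ((hX univ MeasurableSet.univ).compl.inter (MeasurableSet.const _))))

end Legendre

/-! ### Semi-convex functions approximating the potential from below. -/

section Approximation

variable {n : ℕ} {M : Type*} {N : Type*} {c : M × N → ℝ} {a : N → ℝ} {S S' : Set N} {K : ℝ}

/-- The lower envelope `x ↦ inf_{y ∈ S} (c (x, y) - a y)`. -/
noncomputable def lowerEnvelope (c : M × N → ℝ) (a : N → ℝ) (S : Set N) (x : M) : ℝ :=
  sInf ((fun y => c (x, y) - a y) '' S)

theorem bddBelow_image_sub (hc : BddBelow (range c)) (ha : ∀ y ∈ S, a y ≤ K) (x : M) :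
    BddBelow ((fun y => c (x, y) - a y) '' S) := by
  obtain ⟨m, hm⟩ := hc
  refine ⟨m - K, ?_⟩
  rintro _ ⟨y, hy, rfl⟩
  have h1 := hm (mem_range_self (x, y))
  have h2 := ha y hy
  dsimp only
  linarith

theorem lowerEnvelope_le (hc : BddBelow (range c)) (ha : ∀ y ∈ S, a y ≤ K) (x : M) {y : N}
    (hy : y ∈ S) : lowerEnvelope c a S x ≤ c (x, y) - a y :=
  csInf_le (bddBelow_image_sub hc ha x) (mem_image_of_mem _ hy)

theorem lowerEnvelope_anti (hc : BddBelow (range c)) (ha : ∀ y ∈ S, a y ≤ K) (hS' : S'.Nonempty)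
    (h : S' ⊆ S) (x : M) : lowerEnvelope c a S x ≤ lowerEnvelope c a S' x :=
  csInf_le_csInf (bddBelow_image_sub hc ha x) (hS'.image _) (image_mono h)

theorem lowerEnvelope_union (hc : BddBelow (range c)) (ha : ∀ y ∈ S, a y ≤ K)
    (ha' : ∀ y ∈ S', a y ≤ K) (hS : S.Nonempty) (hS' : S'.Nonempty) (x : M) :
    lowerEnvelope c a (S ∪ S') x = min (lowerEnvelope c a S x) (lowerEnvelope c a S' x) := by
  rw [lowerEnvelope, image_union]
  exact csInf_union (bddBelow_image_sub hc ha x) (hS.image _) (bddBelow_image_sub hc ha' x)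
    (hS'.image _)

variable [TopologicalSpace M] [ChartedSpace (EuclideanSpace ℝ (Fin n)) M] [IsManifold (𝓡 n) ∞ M]

theorem UniformlyLocallySemiConcave.isLocallySemiConcave {ι : Type*} {f : ι → M → ℝ}
    (hf : UniformlyLocallySemiConcave n f) (i : ι) : IsLocallySemiConcave n (f i) := by
  obtain ⟨𝒜, h𝒜, hcov, hw⟩ := hf
  refine isLocallySemiConcave_of_exists_chart fun x => ?_
  obtain ⟨e, he, hx⟩ := hcov x
  obtain ⟨w, hw, hfw⟩ := hw e he
  exact ⟨e, h𝒜 he, hx, w, hw, hfw i⟩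

theorem isLocallySemiConcave_lowerEnvelope {V : Set N} (hc : BddBelow (range c))
    (hV : UniformlyLocallySemiConcave n (fun (y : V) (x : M) => c (x, y)))
    (hS : S.Nonempty) (hSV : S ⊆ V) (ha : ∀ y ∈ S, a y ≤ K) :
    IsLocallySemiConcave n (lowerEnvelope (M := M) c a S) := by
  obtain ⟨𝒜, h𝒜, hcov, hw⟩ := hV
  refine isLocallySemiConcave_of_exists_chart fun x => ?_
  obtain ⟨e, he, hx⟩ := hcov x
  obtain ⟨w, hw, hfw⟩ := hw e he
  refine ⟨e, h𝒜 he, hx, w, hw, ?_⟩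
  have := hS.to_subtype
  obtain ⟨m, hm⟩ := hc
  have h1 : SemiConcaveOnWith w
      (fun u => ⨅ y : S, (c (e.symm u, (y : N)) - a y)) e.target := by
    refine SemiConcaveOnWith.iInf e.open_target (b := m - K) (fun y u hu => ?_) fun y u _ => ?_
    · obtain ⟨l, hl⟩ := hfw ⟨y, hSV y.2⟩ u hu
      refine ⟨l, fun v hv => ?_⟩
      simpa using hl v hv
    · have h1 := hm (mem_range_self (e.symm u, (y : N)))
      have h2 := ha y y.2
      linarith
  refine h1.congr fun u _ => ?_
  exact sInf_image'

/-- Each `V i` has its own charts and moduli, so no single modulus serves the union; the envelope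
over finitely many pieces is instead a finite minimum of locally semi-concave functions. -/
theorem isLocallySemiConcave_lowerEnvelope_biUnion {V S : ℕ → Set N} (hc : BddBelow (range c))
    (hV : ∀ i, UniformlyLocallySemiConcave n (fun (y : V i) (x : M) => c (x, y)))
    (hSV : ∀ i, S i ⊆ V i) (ha : ∀ i, ∀ y ∈ S i, a y ≤ K) (k : ℕ)
    (hS : (⋃ i ≤ k, S i).Nonempty) :
    IsLocallySemiConcave n (lowerEnvelope (M := M) c a (⋃ i ≤ k, S i)) := by
  induction k with
  | zero =>
    have h0 : ⋃ i ≤ 0, S i = S 0 := by simp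
    rw [h0] at hS ⊢
    exact isLocallySemiConcave_lowerEnvelope hc (hV 0) hS (hSV 0) (ha 0)
  | succ k ih =>
    rw [biUnion_le_succ] at hS ⊢
    rcases (⋃ i ≤ k, S i).eq_empty_or_nonempty with h | h
    · rw [h, empty_union] at hS ⊢
      exact isLocallySemiConcave_lowerEnvelope hc (hV _) hS (hSV _) (ha _)
    rcases (S (k + 1)).eq_empty_or_nonempty with h' | h'
    · rw [h', union_empty]
      exact ih h
    have ha' : ∀ y ∈ ⋃ i ≤ k, S i, a y ≤ K := by
      intro y hy
      obtain ⟨i, -, hi⟩ := mem_iUnion₂.1 hy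
      exact ha i y hi
    rw [funext (lowerEnvelope_union hc ha' (ha _) h h')]
    exact (ih h).min (isLocallySemiConcave_lowerEnvelope hc (hV _) h' (hSV _) (ha _))

theorem IsSubsolution.exists_approximation [TopologicalSpace N] [SecondCountableTopology N]
    (hc : BddBelow (range c)) (hconc : LocallyUniformlyLocallySemiConcave n c)
    {φ : M → EReal} {ψ : N → EReal} (hsub : IsSubsolution c φ ψ) (hψ : ∃ y, ψ y ≠ ⊥) :
    ∃ φs : ℕ → M → ℝ, (∀ k, IsLocallySemiConvex n (φs k)) ∧ (∀ k x, φs k x ≤ φs (k + 1) x) ∧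
      (∀ k x, (φs k x : EReal) ≤ φ x) ∧
      ∀ p ∈ contactSet c φ ψ, ∃ m, (∀ j ≥ m, φs j p.1 = φs m p.1) ∧
        ∀ z, c p + φs m p.1 ≤ c (z, p.2) + φs m z := by
  obtain ⟨y₁, hy₁⟩ := hψ
  choose V hV hVconc using hconc
  obtain ⟨s, hs, hsV⟩ := TopologicalSpace.countable_cover_nhds hV
  have hsne : s.Nonempty := by
    obtain ⟨i, hi, -⟩ := mem_iUnion₂.1 (hsV ▸ mem_univ y₁)
    exact ⟨i, hi⟩
  obtain ⟨v, rfl⟩ := hs.exists_eq_range hsne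
  have hcov : ∀ y, ∃ i, y ∈ V (v i) := by
    intro y
    have := hsV ▸ mem_univ y
    simpa using this
  set a : N → ℝ := fun y => (ψ y).toReal
  have hψa : ∀ y, ψ y ≠ ⊥ → ψ y = a y := fun y hy =>
    (EReal.coe_toReal (hsub.ne_top y) hy).symm
  -- The bound `a y ≤ k` keeps `c (x, y) - a y` bounded below on `S k i`.
  let S : ℕ → ℕ → Set N := fun k i => V (v i) ∩ {y | ψ y ≠ ⊥ ∧ a y ≤ k}
  let W : ℕ → Set N := fun k => ⋃ i ≤ k, S k i
  have hWmem : ∀ k y, y ∈ W k ↔ (∃ i ≤ k, y ∈ V (v i)) ∧ ψ y ≠ ⊥ ∧ a y ≤ k := by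
    intro k y
    simp only [W, S, mem_iUnion₂, mem_inter_iff, exists_prop]
    constructor
    · rintro ⟨i, hi, hy, h⟩
      exact ⟨⟨i, hi, hy⟩, h⟩
    · rintro ⟨⟨i, hi, hy⟩, h⟩
      exact ⟨i, hi, hy, h⟩
  have hWmono : Monotone W := by
    intro k k' hk y hy
    rw [hWmem] at hy ⊢
    obtain ⟨⟨i, hi, hy⟩, h1, h2⟩ := hy
    exact ⟨⟨i, hi.trans hk, hy⟩, h1, h2.trans (Nat.cast_le.2 hk)⟩
  have hWex : ∀ y, ψ y ≠ ⊥ → ∃ k, y ∈ W k := by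
    intro y hy
    obtain ⟨i, hi⟩ := hcov y
    obtain ⟨j, hj⟩ := exists_nat_ge (a y)
    exact ⟨max i j, (hWmem _ _).2 ⟨⟨i, le_max_left _ _, hi⟩, hy,
      hj.trans (Nat.cast_le.2 (le_max_right _ _))⟩⟩
  -- Since `sInf ∅ = 0`, the envelope over an empty set is meaningless; shifting the index by `k₀`
  -- ensures that every `W (k + k₀)` contains `y₁`.
  obtain ⟨k₀, hk₀⟩ := hWex y₁ hy₁
  have hWne : ∀ k, (W (k + k₀)).Nonempty := fun k => ⟨y₁, hWmono (Nat.le_add_left _ _) hk₀⟩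
  have hWa : ∀ k, ∀ y ∈ W k, a y ≤ k := fun k y hy => ((hWmem k y).1 hy).2.2
  have hmono : ∀ k k', k ≤ k' → ∀ x, -lowerEnvelope c a (W (k + k₀)) x ≤
      -lowerEnvelope c a (W (k' + k₀)) x := fun k k' hk x =>
    neg_le_neg (lowerEnvelope_anti hc (hWa _) (hWne k) (hWmono (by omega)) x)
  have hle : ∀ x, ∀ r : ℝ, φ x = r → ∀ k, -r ≤ lowerEnvelope c a (W k) x ∨ ¬ (W k).Nonempty := by
    intro x r hr k
    by_cases hne : (W k).Nonempty
    · refine Or.inl (le_csInf (hne.image _) ?_)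
      rintro _ ⟨y, hy, rfl⟩
      have h1 := hsub.sub_le x y
      rw [hψa y ((hWmem k y).1 hy).2.1, hr, ← EReal.coe_sub, EReal.coe_le_coe_iff] at h1
      dsimp only
      linarith
    · exact Or.inr hne
  refine ⟨fun k x => -lowerEnvelope c a (W (k + k₀)) x, fun k => ?_,
    fun k x => hmono _ _ (Nat.le_succ k) x, fun k x => ?_, ?_⟩
  · have h1 := isLocallySemiConcave_lowerEnvelope_biUnion (M := M) (a := a) (K := (k + k₀ : ℕ))
      (V := fun i => V (v i)) (S := S (k + k₀)) hc (fun i => hVconc (v i))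
      (fun i => inter_subset_left) (fun i y hy => hy.2.2) (k + k₀) (hWne k)
    simpa [IsLocallySemiConvex] using h1
  · by_cases hφ : φ x = ⊤
    · rw [hφ]
      exact le_top
    · have hr := (EReal.coe_toReal hφ (hsub.ne_bot x)).symm
      rcases hle x _ hr (k + k₀) with h | h
      · rw [hr, EReal.coe_le_coe_iff]
        linarith
      · exact absurd (hWne k) h
  · rintro ⟨x, y⟩ hp
    have hp' : ψ y - φ x = (c (x, y) : EReal) := hp
    have hψy : ψ y ≠ ⊥ := by
      intro h
      rw [h, EReal.bot_sub] at hp'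
      exact EReal.bot_ne_coe _ hp'
    have hφx : φ x ≠ ⊤ := by
      intro h
      rw [h, EReal.sub_top] at hp'
      exact EReal.bot_ne_coe _ hp'
    have hr := (EReal.coe_toReal hφx (hsub.ne_bot x)).symm
    rw [hψa y hψy, hr, ← EReal.coe_sub, EReal.coe_eq_coe_iff] at hp'
    obtain ⟨m, hm⟩ := hWex y hψy
    -- Once `y` belongs to `W`, it attains the infimum at `x`: the envelope is at least `-φ x` by
    -- the subsolution inequality, and contact says that `c (x, y) - a y` equals `-φ x`.
    have hval : ∀ j ≥ m, lowerEnvelope c a (W (j + k₀)) x = c (x, y) - a y := by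
      intro j hj
      refine le_antisymm (lowerEnvelope_le hc (hWa _) x (hWmono (by omega) hm)) ?_
      rcases hle x _ hr (j + k₀) with h | h
      · linarith
      · exact absurd (hWne j) h
    refine ⟨m, fun j hj => ?_, fun z => ?_⟩
    · dsimp only
      rw [hval j hj, hval m le_rfl]
    · have h1 := lowerEnvelope_le hc (hWa (m + k₀)) z (hWmono (Nat.le_add_right m k₀) hm)
      have h2 := hval m le_rfl
      dsimp only
      linarith

end Approximation
end Transport

/-! ### Construction of the exceptional set and of the transport map. -/

open Transport in
theorem theorem3p1 (n : ℕ)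
    {M : Type*} [TopologicalSpace M] [T2Space M] [SecondCountableTopology M]
    [ChartedSpace (EuclideanSpace ℝ (Fin n)) M] [IsManifold (𝓡 n) ∞ M]
    [MeasurableSpace M] [BorelSpace M]
    {N : Type*} [TopologicalSpace N] [PolishSpace N] [MeasurableSpace N] [BorelSpace N]
    (c : M × N → ℝ) (hc_meas : Measurable c) (hc_bdd : BddBelow (Set.range c))
    (hc_conc : Transport.LocallyUniformlyLocallySemiConcave n c)
    (hc_twist : Transport.LeftTwist n c)
    (φ : M → EReal) (ψ : N → EReal) (hsub : Transport.IsSubsolution c φ ψ)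
    (hψ : ∃ y, ψ y ≠ ⊥) (y₀ : N) :
    ∃ (E : Set M) (T : M → N) (φs : ℕ → M → ℝ) (C : ℕ → Set M),
      -- the Borel exceptional set and the Borel map
      MeasurableSet E ∧ Transport.IsCountablyLipschitz n E ∧ Measurable T ∧
      Transport.contactSet c φ ψ ⊆ Set.univ.graphOn T ∪ Prod.fst ⁻¹' E ∧
      -- the increasing sequence of locally semi-convex functions below `φ`
      (∀ k, Transport.IsLocallySemiConvex n (φs k)) ∧
      (∀ k x, φs k x ≤ φs (k + 1) x) ∧
      (∀ k x, (φs k x : EReal) ≤ φ x) ∧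
      -- the increasing sequence of Borel sets
      (∀ k, MeasurableSet (C k)) ∧
      (∀ k, C k ⊆ C (k + 1)) ∧
      (∀ k, ∀ x ∈ C k, Transport.DiffAt n (φs k) x ∧ Transport.DiffAt n (φs (k + 1)) x ∧
        φs (k + 1) x = φs k x ∧
        Transport.differential n (φs (k + 1)) x = Transport.differential n (φs k) x) ∧
      (Prod.fst '' Transport.contactSet c φ ψ) \ E ⊆ ⋃ k, C k ∧
      -- the description of `T` on the sets `C k`
      (∀ k, ∀ x ∈ C k,
        (x, T x) = Transport.legendreInv n c y₀ ⟨x, -Transport.differential n (φs k) x⟩) ∧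
      (∀ k, ∀ x ∈ ((Prod.fst '' Transport.contactSet c φ ψ) ∩ C k) \ E,
        (x, T x) ∈ Transport.legendreDomain n c ∧
        Transport.partialDeriv n c x (T x) = -Transport.differential n (φs k) x ∧
        Transport.legendre n c (x, T x) = ⟨x, -Transport.differential n (φs k) x⟩ ∧
        -- uniqueness of `T x`
        ∀ y, (x, y) ∈ Transport.legendreDomain n c →
          Transport.partialDeriv n c x y = -Transport.differential n (φs k) x → y = T x) := by
  classical
  have hconc : ∀ y, IsLocallySemiConcave n fun x => c (x, y) := by
    intro y
    obtain ⟨V, hV, hf⟩ := hc_conc y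
    exact hf.isLocallySemiConcave ⟨y, mem_of_mem_nhds hV⟩
  obtain ⟨φs, hconv, hmono, hle, hcontact⟩ := hsub.exists_approximation hc_bdd hc_conc hψ
  have hmono' : ∀ x, Monotone fun k => φs k x := fun x => monotone_nat_of_le_succ fun k => hmono k x
  have hcont : ∀ k, Continuous (φs k) := fun k =>
    (IsLocallySemiConcave.continuous (hconv k)).neg.congr fun x => neg_neg _
  set E : Set M := ⋃ k, {x | ¬ DiffAt n (φs k) x}
  have hdiff : ∀ x, x ∉ E → ∀ k, DiffAt n (φs k) x := by
    intro x hx k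
    by_contra h
    exact hx (Set.mem_iUnion.2 ⟨k, h⟩)
  set C : ℕ → Set M := fun k => {x | x ∉ E ∧ ∀ j ≥ k, φs j x = φs k x}
  have hEmeas : MeasurableSet E := MeasurableSet.iUnion fun k => (measurableSet_diffAt _).compl
  have hCmeas : ∀ k, MeasurableSet (C k) := by
    intro k
    have : C k = Eᶜ ∩ ⋂ j : ℕ, ⋂ _ : j ≥ k, {x | φs j x = φs k x} := by
      ext x
      simp [C]
    rw [this]
    exact hEmeas.compl.inter (MeasurableSet.iInter fun j => MeasurableSet.iInter fun _ =>
      measurableSet_eq_fun (hcont j).measurable (hcont k).measurable)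
  -- For `x ∈ C k` and `j ≥ k`, `φs j` lies above `φs k` and touches it at `x`, so their
  -- differentials there agree.
  have hCdiff : ∀ k, ∀ x ∈ C k, ∀ j ≥ k,
      differential n (φs j) x = differential n (φs k) x := fun k x hx j hj =>
    differential_eq_of_le_of_eq (hdiff x hx.1 k) (hdiff x hx.1 j) (fun z => hmono' z hj)
      (hx.2 j hj).symm
  let T' : ℕ → M → N := fun k x => (legendreInv n c y₀ ⟨x, -differential n (φs k) x⟩).2
  -- The least admissible index is only a choice: by `hCdiff` every `k` with `x ∈ C k` yields the
  -- same covector, hence the same value.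
  let T : M → N := fun x => if h : ∃ k, x ∈ C k then T' (Nat.find h) x else y₀
  have hTC : ∀ k, ∀ x ∈ C k, T x = T' k x := by
    intro k x hx
    have hex : ∃ k, x ∈ C k := ⟨k, hx⟩
    have h1 := hCdiff _ x (Nat.find_spec hex) k (Nat.find_min' hex hx)
    simp only [T, dif_pos hex, T', h1]
  have hTinv : ∀ k, ∀ x ∈ C k,
      (x, T x) = legendreInv n c y₀ ⟨x, -differential n (φs k) x⟩ := by
    intro k x hx
    rw [hTC k x hx]
    exact Prod.ext (legendreInv_fst hc_twist y₀).symm rfl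
  have hTmeas : Measurable T := by
    intro B hB
    have : T ⁻¹' B = (⋃ k, C k ∩ {x | DiffAt n (φs k) x ∧ T' k x ∈ B}) ∪
        ((⋃ k, C k)ᶜ ∩ {_x | y₀ ∈ B}) := by
      ext x
      by_cases h : ∃ k, x ∈ C k
      · obtain ⟨k, hk⟩ := h
        constructor
        · intro hx
          refine Or.inl (Set.mem_iUnion.2 ⟨k, hk, hdiff x hk.1 k, ?_⟩)
          rw [← hTC k x hk]
          exact hx
        · rintro (hx | hx)
          · obtain ⟨j, hj, -, hx⟩ := Set.mem_iUnion.1 hx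
            rw [← hTC j x hj] at hx
            exact hx
          · exact absurd (Set.mem_iUnion.2 ⟨k, hk⟩) hx.1
      · have hT : T x = y₀ := dif_neg h
        constructor
        · intro hx
          refine Or.inr ⟨fun hx => h (Set.mem_iUnion.1 hx), ?_⟩
          rw [Set.mem_preimage, hT] at hx
          exact hx
        · rintro (hx | hx)
          · obtain ⟨j, hj, -⟩ := Set.mem_iUnion.1 hx
            exact absurd ⟨j, hj⟩ h
          · rw [Set.mem_preimage, hT]
            exact hx.2
    rw [this]
    exact (MeasurableSet.iUnion fun k => (hCmeas k).inter
      (measurableSet_legendreInv_snd_mem hc_meas hconc hc_twist y₀ (φs k) hB)).union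
      ((MeasurableSet.iUnion hCmeas).compl.inter (MeasurableSet.const _))
  have hkey : ∀ p ∈ contactSet c φ ψ, p.1 ∉ E → ∃ m, p.1 ∈ C m ∧ p ∈ legendreDomain n c ∧
      partialDeriv n c p.1 p.2 = -differential n (φs m) p.1 := by
    intro p hp hpE
    obtain ⟨m, hm, hmin⟩ := hcontact p hp
    have := differential_eq_neg_of_isLocalMin_add (hconc p.2) (hdiff p.1 hpE m) hmin
    exact ⟨m, ⟨hpE, hm⟩, this.1, this.2⟩
  have hTkey : ∀ p ∈ contactSet c φ ψ, p.1 ∉ E → T p.1 = p.2 := by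
    intro p hp hpE
    obtain ⟨m, hm, hpD, hpd⟩ := hkey p hp hpE
    have h1 := hTinv m p.1 hm
    rw [legendreInv_of_mem (y := p.2) hc_twist y₀ hpD hpd] at h1
    exact (Prod.mk.inj h1).2
  refine ⟨E, T, φs, C, hEmeas, ?_, hTmeas, ?_, hconv, hmono, hle, hCmeas, ?_, ?_, ?_, hTinv, ?_⟩
  · refine IsCountablyLipschitz.iUnion fun k => ?_
    have h1 := IsLocallySemiConcave.isCountablyLipschitz (hconv k)
    simpa only [diffAt_neg_iff] using h1
  · intro p hp
    by_cases hpE : p.1 ∈ E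
    · exact Or.inr hpE
    · exact Or.inl ⟨p.1, Set.mem_univ _, Prod.ext rfl (hTkey p hp hpE)⟩
  · rintro k x ⟨hxE, hx⟩
    exact ⟨hxE, fun j hj => (hx j (by omega)).trans (hx (k + 1) (by omega)).symm⟩
  · intro k x hx
    exact ⟨hdiff x hx.1 _, hdiff x hx.1 _, hx.2 _ (Nat.le_succ k), hCdiff k x hx _ (Nat.le_succ k)⟩
  · rintro _ ⟨⟨p, hp, rfl⟩, hpE⟩
    obtain ⟨m, hm, -⟩ := hkey p hp hpE
    exact Set.mem_iUnion.2 ⟨m, hm⟩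
  · rintro k _ ⟨⟨⟨p, hp, rfl⟩, hk⟩, hpE⟩
    obtain ⟨m, hm, hpD, hpd⟩ := hkey p hp hpE
    -- The index `m` supplied by the contact point need not be the given `k`; on `C m ∩ C k` both
    -- differentials coincide.
    have h1 : differential n (φs m) p.1 = differential n (φs k) p.1 := by
      rcases le_total k m with h | h
      · exact hCdiff k _ hk m h
      · exact (hCdiff m _ hm k h).symm
    rw [h1] at hpd
    rw [hTkey p hp hpE]
    refine ⟨hpD, hpd, congrArg (Bundle.TotalSpace.mk p.1) hpd, fun y hy hyd => ?_⟩
    have h2 := (legendreInv_of_mem hc_twist y₀ hy hyd).symm.trans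
      (legendreInv_of_mem (y := p.2) hc_twist y₀ hpD hpd)
    exact (Prod.mk.inj h2).2
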